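/- **Theorem 4.2.** Let $T$ be a set of types. An oriented multi-virtual link diagram is an oriented link diagram in the plane in which every crossing is either classical (with over/under information) or virtual and labelled by a type from $T$. Two such diagrams are *equivalent* if they are related by finitely many planar isotopies, classical Reidemeister moves and multi-virtual detour moves; a multi-virtual detour move takes a strand meeting $m$ strands at virtual crossings of one and the same type $\alpha$, moves it across an arbitrary $m,n$-tangle so that it then meets $n$ strands at virtual crossings of type $\alpha$, and may freely add or remove loops with a virtual crossing of type $\alpha$ on the strand. Let $(Q,*)$ be a quandle (right self-distributive, idempotent, with bijective right translations $R_a(x)=x*a$; write $b/a=R_a^{-1}(b)$) and let $(\alpha)_{\alpha\in T}$ be a family of pairwise commuting automorphisms of $(Q,*)$, written $A_T$, not necessarily distinct. A *coloring* of a diagram assigns elements of $Q$ to its arcs (cut at all crossings) so that: - at a classical crossing the over-strand keeps its color $b$, and the color of the under-strand changes, along its orientation, from $a$ to $a*b$ if the crossing is positive and from $a$ to $a/b$ if it is negative; - at a virtual crossing of type $\alpha$, drawn with both strands running upwards, the color of the strand running from lower right to upper left changes from $a$ to $\alpha(a)$, and that of the strand running from lower left to upper right changes from $b$ to $\alpha^{-1}(b)$.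 Let $G$ be an abelian group, written multiplicatively, and let $\phi:Q\times Q\to G$ be an *operator quandle 2-cocycle*, i.e. for all $a,b,c\in Q$ and all $\alpha\in T$ $$\phi(a,a)=1,\qquad \phi(a,b)\,\phi(a*b,c)=\phi(a,c)\,\phi(a*c,b*c),\qquad \phi(\alpha(a),\alpha(b))=\phi(a,b).$$ For a coloring $C$ of a diagram $D$, a positive classical crossing has weight $\phi(a,b)$, where $a$ is the color of the incoming under-arc and $b$ that of the over-arc; a negative classical crossing has weight $\phi(a,b)^{-1}$, where $a$ is the color of the *outgoing* under-arc and $b$ that of the over-arc. (In both cases $a$ is the color of the under-arc to the right of the over-arc.) If $D$ has only finitely many colorings, in particular if $Q$ is finite, put $$\mathrm{Coc}(D,Q,*,A_T,\phi)=\sum_{C}\ \prod_{c}\phi(a,b)^{\epsilon(c)}\in\mathbb Z[G],$$ where $C$ runs over all colorings of $D$, $c$ runs over all classical crossings of $D$ and $\epsilon(c)=\pm1$ is the sign of $c$; empty products are $1$ and empty sums are $0$. Let $D_1$ and $D_2$ be equivalent oriented multi-virtual link diagrams. Then $D_1$ has finitely many colorings if and only if $D_2$ does, and in that case $$\mathrm{Coc}(D_1,Q,*,A_T,\phi)=\mathrm{Coc}(D_2,Q,*,A_T,\phi).$$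 -/

import Mathlib

open scoped Quandles

namespace MultiVirtual

universe u v w

/-! ### Oriented multi-virtual tangle and link diagrams

A diagram in the plane in general position with respect to the height function is cut by horizontal
lines into strips, each of which contains exactly one cup, one cap or one crossing, all other
strands running straight through the strip. A diagram is recorded as the list of its strips, read
from bottom to top. -/

/-- The direction in which a strand traverses a horizontal line. -/
inductive Dir
  | up
  | down
  deriving DecidableEq

/-- The reversed direction. -/
def Dir.flip : Dir → Dir
  | .up => .down
  | .down => .up

/-- The kind of a crossing between the strand joining the lower left to the upper right corner
(the *first* strand) and the strand joining the lower right to the upper left corner (the *second*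
strand). `classical true` means that the first strand passes over the second one,
`classical false` that the second strand passes over the first one, and `virtual t` is a virtual
crossing of type `t`. -/
inductive Kind (T : Type u)
  | classical (firstOver : Bool)
  | virtual (t : T)

/-- The kind of the same crossing when the two strands are named in the other order. -/
def Kind.flip {T : Type u} : Kind T → Kind T
  | .classical o => .classical (!o)
  | .virtual t => .virtual t

/-- The elementary pieces of a diagram. `cup d` and `cap d` are a local minimum and a local maximum
whose left leg has direction `d`; `cross k d₁ d₂` is a crossing of kind `k` with first strand of
direction `d₁` and second strand of direction `d₂`. -/
inductive Gen (T : Type u)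
  | cup (d : Dir)
  | cap (d : Dir)
  | cross (k : Kind T) (d₁ d₂ : Dir)

/-- The directions of the strands at the lower end of an elementary piece, from left to right. -/
def Gen.src {T : Type u} : Gen T → List Dir
  | .cup _ => []
  | .cap d => [d, d.flip]
  | .cross _ d₁ d₂ => [d₁, d₂]

/-- The directions of the strands at the upper end of an elementary piece, from left to right. -/
def Gen.tgt {T : Type u} : Gen T → List Dir
  | .cup d => [d, d.flip]
  | .cap _ => []
  | .cross _ d₁ d₂ => [d₂, d₁]

/-- A horizontal strip: an elementary piece with vertical strands to its left and to its right. -/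
structure Slice (T : Type u) where
  left : List Dir
  gen : Gen T
  right : List Dir

/-- The directions of the strands on the lower boundary of a strip. -/
def Slice.src {T : Type u} (s : Slice T) : List Dir := s.left ++ s.gen.src ++ s.right

/-- The directions of the strands on the upper boundary of a strip. -/
def Slice.tgt {T : Type u} (s : Slice T) : List Dir := s.left ++ s.gen.tgt ++ s.right

/-- `IsTangle m W n`: the strips of `W`, stacked from bottom to top, fit together to an oriented
tangle diagram with lower boundary `m` and upper boundary `n`. -/
def IsTangle {T : Type u} : List Dir → List (Slice T) → List Dir → Prop
  | m, [], n => m = n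
  | m, s :: W, n => m = s.src ∧ IsTangle s.tgt W n

/-- An oriented multi-virtual link diagram with virtual crossings typed by `T`: an oriented tangle
diagram without boundary. -/
structure Diagram (T : Type u) where
  strips : List (Slice T)
  closed : IsTangle [] strips []

/-- Add vertical strands `L` to the left and `R` to the right of a tangle diagram. -/
def whisker {T : Type u} (L R : List Dir) (W : List (Slice T)) : List (Slice T) :=
  W.map fun s => ⟨L ++ s.left, s.gen, s.right ++ R⟩

/-- A strand of direction `d` that starts to the left of the parallel strands `m`, crosses all of
them at virtual crossings of the same type `t`, and ends to the right of them. -/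
def sweep {T : Type u} (t : T) (d : Dir) : List Dir → List (Slice T)
  | [] => []
  | e :: m => ⟨[], .cross (.virtual t) d e, m⟩ :: whisker [e] [] (sweep t d m)

/-! ### Equivalence of diagrams -/

/-- Planar isotopy of diagrams that are cut into strips: the heights of two distant elementary
pieces are exchanged, a local maximum and a local minimum are created or cancelled, or a local
maximum or minimum of one strand is pushed through a crossing with another strand. -/
inductive IsotopyMove {T : Type u} : List (Slice T) → List (Slice T) → Prop
  | exchange (g h : Gen T) (M : List Dir) :
      IsotopyMove [⟨[], g, M ++ h.src⟩, ⟨g.tgt ++ M, h, []⟩]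
        [⟨g.src ++ M, h, []⟩, ⟨[], g, M ++ h.tgt⟩]
  | zigzagLeft (d : Dir) : IsotopyMove [⟨[], .cup d, [d]⟩, ⟨[d], .cap d.flip, []⟩] []
  | zigzagRight (d : Dir) : IsotopyMove [⟨[d], .cup d.flip, []⟩, ⟨[], .cap d, [d]⟩] []
  | slideCap (k : Kind T) (d e : Dir) :
      IsotopyMove [⟨[], .cross k d e, [d.flip]⟩, ⟨[e], .cap d, []⟩]
        [⟨[d], .cross k.flip e d.flip, []⟩, ⟨[], .cap d, [e]⟩]
  | slideCup (k : Kind T) (d e : Dir) :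
      IsotopyMove [⟨[e], .cup d, []⟩, ⟨[], .cross k e d, [d.flip]⟩]
        [⟨[], .cup d, [e]⟩, ⟨[d], .cross k.flip d.flip e, []⟩]

/-- A kink with a crossing of kind `k` in a strand of direction `d`, on the right or on the left of
the strand. -/
inductive IsKink {T : Type u} (k : Kind T) : List (Slice T) → Prop
  | right (d : Dir) :
      IsKink k [⟨[d], .cup d, []⟩, ⟨[], .cross k d d, [d.flip]⟩, ⟨[d], .cap d, []⟩]
  | left (d : Dir) :
      IsKink k [⟨[], .cup d.flip, [d]⟩, ⟨[d.flip], .cross k d d, []⟩, ⟨[], .cap d.flip, [d]⟩]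

/-- The classical Reidemeister moves, with all orientations. In the third move `a`, `b`, `c` tell
which strand is on top where the strands 1 and 2, 1 and 3, 2 and 3 cross; the hypothesis excludes
the two cyclic configurations, in which no strand is on top of the two others. -/
inductive ReidemeisterMove {T : Type u} : List (Slice T) → List (Slice T) → Prop
  | r1 (o : Bool) {K : List (Slice T)} (hK : IsKink (.classical o) K) : ReidemeisterMove K []
  | r2 (o : Bool) (d₁ d₂ : Dir) :
      ReidemeisterMove [⟨[], .cross (.classical o) d₁ d₂, []⟩,
        ⟨[], .cross (.classical !o) d₂ d₁, []⟩] []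
  | r3 (a b c : Bool) (d₁ d₂ d₃ : Dir) (h : a = c → b = a) :
      ReidemeisterMove
        [⟨[], .cross (.classical a) d₁ d₂, [d₃]⟩, ⟨[d₂], .cross (.classical b) d₁ d₃, []⟩,
          ⟨[], .cross (.classical c) d₂ d₃, [d₁]⟩]
        [⟨[d₁], .cross (.classical c) d₂ d₃, []⟩, ⟨[], .cross (.classical b) d₁ d₃, [d₂]⟩,
          ⟨[d₃], .cross (.classical a) d₁ d₂, []⟩]

/-- The multi-virtual detour moves: a strand meeting the strands `m` at virtual crossings of type
`t` is moved across an arbitrary tangle `W` from `m` to `n`, after which it meets the strands `n`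
at virtual crossings of the same type `t`; and loops with a virtual crossing are freely added to or
removed from a strand. -/
inductive DetourMove {T : Type u} : List (Slice T) → List (Slice T) → Prop
  | across (t : T) (d : Dir) {m n : List Dir} {W : List (Slice T)} (hW : IsTangle m W n) :
      DetourMove (sweep t d m ++ whisker [] [d] W) (whisker [d] [] W ++ sweep t d n)
  | loop (t : T) {K : List (Slice T)} (hK : IsKink (.virtual t) K) : DetourMove K []

/-- One of the moves is applied somewhere in a link diagram. -/
def Diagram.Step {T : Type u} (D D' : Diagram T) : Prop :=
  ∃ (X X' : List (Slice T)) (L R : List Dir) (below above : List (Slice T)),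
    (IsotopyMove X X' ∨ ReidemeisterMove X X' ∨ DetourMove X X') ∧
    D.strips = below ++ whisker L R X ++ above ∧ D'.strips = below ++ whisker L R X' ++ above

/-- Equivalence of oriented multi-virtual link diagrams: finitely many planar isotopies, classical
Reidemeister moves, multi-virtual detour moves and their inverses. -/
def Diagram.Equivalent {T : Type u} (D D' : Diagram T) : Prop :=
  Relation.EqvGen Diagram.Step D D'

/-! ### Operator quandles and cocycles

Mathlib writes the quandle operation as a left action; the right operations are
`a * b = b ◃ a` and `b / a = a ◃⁻¹ b` (the unique `x` with `x * a = b`). -/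

/-- A family of pairwise commuting automorphisms of the quandle `Q` indexed by `T`. -/
structure Operators (T : Type u) (Q : Type v) [Quandle Q] where
  op : T → Equiv.Perm Q
  map_act : ∀ (t : T) (x y : Q), op t (x ◃ y) = op t x ◃ op t y
  comm : ∀ s t : T, Commute (op s) (op t)

/-- `φ` is a quandle 2-cocycle, that is, `φ(a,a) = 1` and
`φ(a,b) φ(a*b,c) = φ(a,c) φ(a*c,b*c)`, and it is invariant under all the given automorphisms. -/
structure IsOperatorCocycle {T : Type u} {Q : Type v} [Quandle Q] {G : Type w} [CommGroup G]
    (A : Operators T Q) (φ : Q → Q → G) : Prop where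
  self : ∀ a : Q, φ a a = 1
  cocycle : ∀ a b c : Q, φ a b * φ (b ◃ a) c = φ a c * φ (c ◃ a) (c ◃ b)
  invariant : ∀ (t : T) (a b : Q), φ (A.op t a) (A.op t b) = φ a b

/-! ### Colorings and the state sum -/

/-- The colour with which a strand enters a strip, given its colours at the bottom and the top. -/
def Dir.incoming {Q : Type v} (d : Dir) (bottom top : Q) : Q :=
  match d with
  | .up => bottom
  | .down => top

/-- The colour with which a strand leaves a strip, given its colours at the bottom and the top. -/
def Dir.outgoing {Q : Type v} (d : Dir) (bottom top : Q) : Q :=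
  match d with
  | .up => top
  | .down => bottom

/-- The sign of a classical crossing: it is positive iff the direction of the over-strand is turned
to that of the under-strand by a counterclockwise rotation through a right angle. -/
def isPositive (firstOver : Bool) (d₁ d₂ : Dir) : Bool := firstOver == decide (d₁ = d₂)

/-- The coloring rule at a classical crossing for the under-strand: its colour changes from `a` to
`a * b` if the crossing is positive and to `a / b` if it is negative, `b` being the colour `z` of the
over-strand. -/
def UnderRule {Q : Type v} [Quandle Q] (positive : Bool) (incoming outgoing z : Q) : Prop :=
  match positive with
  | true => outgoing = z ◃ incoming
  | false => outgoing = z ◃⁻¹ incoming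

/-- The weight of a classical crossing: `φ(a,b)` if it is positive, where `a` is the colour of the
incoming under-arc and `b` that of the over-strand, and `φ(a,b)⁻¹` if it is negative, where `a` is
the colour of the outgoing under-arc. In both cases `a` belongs to the under-arc on the right of
the over-strand. -/
def underWeight {Q : Type v} {G : Type w} [CommGroup G] (φ : Q → Q → G)
    (positive : Bool) (incoming outgoing z : Q) : G :=
  match positive with
  | true => φ incoming z
  | false => (φ outgoing z)⁻¹

/-- The coloring rule at a crossing. The first strand has the colours `x₁` at the lower left and
`y₁` at the upper right, the second one `x₂` at the lower right and `y₂` at the upper left. At a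
virtual crossing, turned so that both strands run upwards, `α⁻¹` is applied along the strand that
runs to the right and `α` along the strand that runs to the left. -/
def CrossRule {T : Type u} {Q : Type v} [Quandle Q] (A : Operators T Q)
    (k : Kind T) (d₁ d₂ : Dir) (x₁ x₂ y₂ y₁ : Q) : Prop :=
  match k with
  | .classical true =>
      y₁ = x₁ ∧ UnderRule (isPositive true d₁ d₂) (d₂.incoming x₂ y₂) (d₂.outgoing x₂ y₂) x₁
  | .classical false =>
      y₂ = x₂ ∧ UnderRule (isPositive false d₁ d₂) (d₁.incoming x₁ y₁) (d₁.outgoing x₁ y₁) x₂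
  | .virtual t =>
      if d₁ = d₂ then
        d₁.outgoing x₁ y₁ = (A.op t)⁻¹ (d₁.incoming x₁ y₁) ∧
          d₂.outgoing x₂ y₂ = A.op t (d₂.incoming x₂ y₂)
      else
        d₁.outgoing x₁ y₁ = A.op t (d₁.incoming x₁ y₁) ∧
          d₂.outgoing x₂ y₂ = (A.op t)⁻¹ (d₂.incoming x₂ y₂)

/-- The coloring rule at an elementary piece, whose strands have the colours `b` at the bottom and
`c` at the top, from left to right. -/
def GenRule {T : Type u} {Q : Type v} [Quandle Q] (A : Operators T Q)
    (g : Gen T) (b c : List Q) : Prop :=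
  match g, b, c with
  | .cup _, [], [x, y] => x = y
  | .cap _, [x, y], [] => x = y
  | .cross k d₁ d₂, [x₁, x₂], [y₂, y₁] => CrossRule A k d₁ d₂ x₁ x₂ y₂ y₁
  | _, _, _ => False

/-- The weight of an elementary piece: that of the crossing if it is a classical crossing, and `1`
otherwise. -/
def genWeight {T : Type u} {Q : Type v} {G : Type w} [CommGroup G] (φ : Q → Q → G)
    (g : Gen T) (b c : List Q) : G :=
  match g, b, c with
  | .cross (.classical true) d₁ d₂, [x₁, x₂], [y₂, _] =>
      underWeight φ (isPositive true d₁ d₂) (d₂.incoming x₂ y₂) (d₂.outgoing x₂ y₂) x₁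
  | .cross (.classical false) d₁ d₂, [x₁, x₂], [_, y₁] =>
      underWeight φ (isPositive false d₁ d₂) (d₁.incoming x₁ y₁) (d₁.outgoing x₁ y₁) x₂
  | _, _, _ => 1

/-- The strands on the lower and upper boundaries of the strip `s` can have the colours `b` and `c`:
the vertical strands keep their colours and the coloring rule holds at the elementary piece. -/
def SliceRule {T : Type u} {Q : Type v} [Quandle Q] (A : Operators T Q)
    (s : Slice T) (b c : List Q) : Prop :=
  ∃ l r b' c' : List Q, l.length = s.left.length ∧ r.length = s.right.length ∧
    b = l ++ b' ++ r ∧ c = l ++ c' ++ r ∧ GenRule A s.gen b' c'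

/-- The weight of a strip whose boundaries have the colours `b` and `c`. -/
def sliceWeight {T : Type u} {Q : Type v} {G : Type w} [CommGroup G] (φ : Q → Q → G)
    (s : Slice T) (b c : List Q) : G :=
  genWeight φ s.gen ((b.drop s.left.length).take s.gen.src.length)
    ((c.drop s.left.length).take s.gen.tgt.length)

/-- A coloring of a tangle diagram with the colours `b` on the lower and `c` on the upper boundary.
It is an assignment of colours to the arcs of the diagram, given by the colours of all strands on
the horizontal lines between the strips. -/
inductive TangleColoring {T : Type u} {Q : Type v} [Quandle Q] (A : Operators T Q) :
    List (Slice T) → List Q → List Q → Type (max u v)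
  | nil (b : List Q) : TangleColoring A [] b b
  | cons {s : Slice T} {W : List (Slice T)} {b c e : List Q}
      (h : SliceRule A s b c) (C : TangleColoring A W c e) : TangleColoring A (s :: W) b e

/-- The product of the weights of all classical crossings of a colored tangle diagram. -/
def TangleColoring.weight {T : Type u} {Q : Type v} [Quandle Q] {A : Operators T Q}
    {G : Type w} [CommGroup G] (φ : Q → Q → G) :
    {W : List (Slice T)} → {b e : List Q} → TangleColoring A W b e → G
  | _, _, _, .nil _ => 1
  | _, _, _, .cons (s := s) (b := b) (c := c) _ C => sliceWeight φ s b c * C.weight φ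

/-- The operator quandle colorings of a link diagram. -/
abbrev Coloring {T : Type u} {Q : Type v} [Quandle Q] (A : Operators T Q) (D : Diagram T) :
    Type (max u v) :=
  TangleColoring A D.strips [] []

/-- The state sum `∑_C ∏_c φ(a,b)^ε` over all colorings of `D`, an element of the group ring
`ℤ[G]` (used when the set of colorings is finite, as it is when `Q` is finite). -/
noncomputable def Coc {T : Type u} {Q : Type v} [Quandle Q] {G : Type w} [CommGroup G]
    (D : Diagram T) (A : Operators T Q) (φ : Q → Q → G) : MonoidAlgebra ℤ G :=
  ∑ᶠ C : Coloring A D, MonoidAlgebra.of ℤ G (C.weight φ)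

end MultiVirtual

/-!
A move replaces a part `X` of a diagram by another tangle `X'`. Since the colorings of stacked
tangles are obtained from the colorings of the parts by summation over the colours in between, it
is enough to find, for all colours on the boundary of `X`, a weight-preserving bijection between
the colorings of `X` and those of `X'` (`IsColorInvariant`). Vertical strands on the sides do not
affect this (`IsColorInvariant.whisker`), and a composition of such bijections identifies the
colorings of equivalent diagrams (`Diagram.Equivalent.sameWeights`), which gives both claims.

From bottom to top, every crossing acts on the colours by permutations. The one acting on a strand
does not depend on the direction of that strand, but on the other strand only (`crossRule_over`,
`crossRule_under`, `crossRule_virtual`), so most orientations can be treated together. For planar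
isotopies and for the Reidemeister moves, a coloring of either side is determined by its boundary.
The third Reidemeister move amounts to `under_under` and `underPhi_cocycle`, which are
self-distributivity and the cocycle condition for all orientations of the two upper strands.

In a detour move, a strand that sweeps over the strands `m` applies the same automorphism `β`, an
operator or its inverse, to all of them, whatever their directions. Its own colour changes by a
power of the operator determined by the winding of `m`, that is, the number of upward strands
minus that of downward strands (`hasUniqueColoring_sweep`). Both boundaries of a tangle have the
same winding, and `β` preserves the coloring rules and the weights of all crossings, virtual ones
included, since the operators are commuting quandle automorphisms that preserve `φ`. Hence it acts
on the colorings of the tangle that is crossed (`IsSymmetry.sameWeights`).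
-/

open scoped Quandles

namespace MultiVirtual

universe u v w

/-! ### Weighted families -/

section SameWeights

variable {G : Type*} {X Y Z : Type*}

/-- Two families of elements of `G` agree up to a bijection of their index types. For the families
of the weights of all colorings this gives the equality of state sums without any assumption of
finiteness. -/
def SameWeights (f : X → G) (g : Y → G) : Prop :=
  ∃ e : X ≃ Y, ∀ x, g (e x) = f x

theorem SameWeights.refl (f : X → G) : SameWeights f f :=
  ⟨Equiv.refl X, fun _ => rfl⟩

theorem SameWeights.symm {f : X → G} {g : Y → G} (h : SameWeights f g) : SameWeights g f := by
  obtain ⟨e, he⟩ := h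
  exact ⟨e.symm, fun y => by rw [← he, e.apply_symm_apply]⟩

theorem SameWeights.trans {f : X → G} {g : Y → G} {k : Z → G} (h : SameWeights f g)
    (h' : SameWeights g k) : SameWeights f k := by
  obtain ⟨e, he⟩ := h
  obtain ⟨e', he'⟩ := h'
  exact ⟨e.trans e', fun x => by rw [Equiv.trans_apply, he', he]⟩

theorem SameWeights.of_isEmpty [IsEmpty X] [IsEmpty Y] (f : X → G) (g : Y → G) :
    SameWeights f g :=
  ⟨Equiv.equivOfIsEmpty X Y, isEmptyElim⟩

theorem SameWeights.of_subsingleton [Subsingleton X] [Subsingleton Y] {f : X → G} {g : Y → G}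
    (h : ∀ a, (∃ x, f x = a) ↔ ∃ y, g y = a) : SameWeights f g := by
  rcases isEmpty_or_nonempty X with hX | ⟨⟨x⟩⟩
  · have : IsEmpty Y := ⟨fun y => by
      obtain ⟨x, -⟩ := (h (g y)).2 ⟨y, rfl⟩
      exact isEmptyElim x⟩
    exact SameWeights.of_isEmpty f g
  · obtain ⟨y, hy⟩ := (h (f x)).1 ⟨x, rfl⟩
    refine ⟨⟨fun _ => y, fun _ => x, fun _ => Subsingleton.elim _ _,
      fun _ => Subsingleton.elim _ _⟩, fun x' => ?_⟩
    rw [Subsingleton.elim x' x]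
    exact hy

theorem SameWeights.sigma {I J : Type*} {X : I → Type*} {Y : J → Type*} {f : ∀ i, X i → G}
    {g : ∀ j, Y j → G} (e : I ≃ J) (h : ∀ i, SameWeights (f i) (g (e i))) :
    SameWeights (fun p : Σ i, X i => f p.1 p.2) (fun q : Σ j, Y j => g q.1 q.2) := by
  choose E hE using h
  exact ⟨Equiv.sigmaCongr e E, fun p => hE p.1 p.2⟩

theorem SameWeights.sigma_right {I : Type*} {X Y : I → Type*} {f : ∀ i, X i → G}
    {g : ∀ i, Y i → G} (h : ∀ i, SameWeights (f i) (g i)) :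
    SameWeights (fun p : Σ i, X i => f p.1 p.2) (fun q : Σ i, Y i => g q.1 q.2) :=
  SameWeights.sigma (Equiv.refl I) h

theorem SameWeights.mul_left [Mul G] {f : X → G} {g : Y → G} (a : G) (h : SameWeights f g) :
    SameWeights (fun x => a * f x) (fun y => a * g y) := by
  obtain ⟨e, he⟩ := h
  exact ⟨e, fun x => congrArg (a * ·) (he x)⟩

theorem SameWeights.mul [Mul G] {X' Y' : Type*} {f : X → G} {g : Y → G} {f' : X' → G}
    {g' : Y' → G} (h : SameWeights f g) (h' : SameWeights f' g') :
    SameWeights (fun p : X × X' => f p.1 * f' p.2) (fun q : Y × Y' => g q.1 * g' q.2) := by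
  obtain ⟨e, he⟩ := h
  obtain ⟨e', he'⟩ := h'
  exact ⟨Equiv.prodCongr e e', fun p => congrArg₂ (· * ·) (he p.1) (he' p.2)⟩

end SameWeights

/-! ### Colorings of composed tangles -/

section Colorings

variable {T : Type u} {Q : Type v} [Quandle Q] {G : Type w} [CommGroup G]
  {A : Operators T Q} {φ : Q → Q → G}

/-- The family of the weights of all colorings of `W` with the boundary colours `b` and `c`. -/
def weights (A : Operators T Q) (φ : Q → Q → G) (W : List (Slice T)) (b c : List Q) :
    TangleColoring A W b c → G :=
  fun C => C.weight φ

theorem exists_weights_nil {b c : List Q} {a : G} :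
    (∃ C, weights A φ [] b c C = a) ↔ b = c ∧ a = 1 := by
  constructor
  · rintro ⟨C, hC⟩
    cases C
    exact ⟨rfl, hC.symm⟩
  · rintro ⟨rfl, rfl⟩
    exact ⟨.nil b, rfl⟩

theorem exists_weights_cons {s : Slice T} {W : List (Slice T)} {b c : List Q} {a : G} :
    (∃ C, weights A φ (s :: W) b c C = a) ↔
      ∃ m, SliceRule A s b m ∧ ∃ C, sliceWeight φ s b m * weights A φ W m c C = a := by
  constructor
  · rintro ⟨C, hC⟩
    cases C with
    | cons h C => exact ⟨_, h, C, hC⟩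
  · rintro ⟨m, h, C, hC⟩
    exact ⟨.cons h C, hC⟩

theorem nonempty_nil_iff {b c : List Q} : Nonempty (TangleColoring A [] b c) ↔ b = c := by
  constructor
  · rintro ⟨C⟩
    cases C
    rfl
  · rintro rfl
    exact ⟨.nil b⟩

theorem nonempty_cons_iff {s : Slice T} {W : List (Slice T)} {b c : List Q} :
    Nonempty (TangleColoring A (s :: W) b c) ↔
      ∃ m, SliceRule A s b m ∧ Nonempty (TangleColoring A W m c) := by
  constructor
  · rintro ⟨C⟩
    cases C with
    | cons h C => exact ⟨_, h, ⟨C⟩⟩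
  · rintro ⟨m, h, ⟨C⟩⟩
    exact ⟨.cons h C⟩

instance subsingleton_nil (b c : List Q) : Subsingleton (TangleColoring A [] b c) :=
  ⟨fun C C' => by cases C; cases C'; rfl⟩

/-- A coloring of `s :: W` consists of the colours above `s` and a coloring of `W`. -/
theorem sameWeights_cons (s : Slice T) (W : List (Slice T)) (b c : List Q) :
    SameWeights (weights A φ (s :: W) b c)
      (fun p : Σ m : {m // SliceRule A s b m}, TangleColoring A W m c =>
        sliceWeight φ s b p.1 * weights A φ W p.1 c p.2) := by
  refine ⟨⟨fun C => match C with | .cons h C => ⟨⟨_, h⟩, C⟩, fun p => .cons p.1.2 p.2, ?_, ?_⟩, ?_⟩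
  · rintro (_ | ⟨h, C⟩)
    rfl
  · rintro ⟨⟨m, h⟩, C⟩
    rfl
  · rintro (_ | ⟨h, C⟩)
    rfl

/-- A coloring of a stack of two tangles, from colorings of the two that agree in between. -/
def TangleColoring.append {W' : List (Slice T)} {m e : List Q} :
    {W : List (Slice T)} → {b : List Q} → TangleColoring A W b m → TangleColoring A W' m e →
      TangleColoring A (W ++ W') b e
  | _, _, .nil _, C' => C'
  | _, _, .cons h C, C' => .cons h (C.append C')

/-- The two parts of a coloring of a stack of two tangles. -/
def TangleColoring.split {W' : List (Slice T)} {e : List Q} :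
    (W : List (Slice T)) → {b : List Q} → TangleColoring A (W ++ W') b e →
      Σ m, TangleColoring A W b m × TangleColoring A W' m e
  | [], b, C => ⟨b, .nil b, C⟩
  | _ :: W, _, .cons h C => ⟨(split W C).1, .cons h (split W C).2.1, (split W C).2.2⟩

theorem TangleColoring.append_split {W' : List (Slice T)} {e : List Q} (W : List (Slice T)) :
    ∀ {b : List Q} (C : TangleColoring A (W ++ W') b e),
      (C.split W).2.1.append (C.split W).2.2 = C := by
  induction W with
  | nil => intro b C; rfl
  | cons s W ih =>
    rintro b (_ | ⟨h, C⟩)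
    exact congrArg (TangleColoring.cons h) (ih C)

theorem TangleColoring.split_append {W' : List (Slice T)} {m e : List Q} {W : List (Slice T)}
    {b : List Q} (C : TangleColoring A W b m) (C' : TangleColoring A W' m e) :
    (C.append C').split W = ⟨m, C, C'⟩ := by
  induction C with
  | nil b => rfl
  | cons h C ih => 
    simp only [append, split]
    rw [ih C']

theorem TangleColoring.weight_append {W' : List (Slice T)} {m e : List Q} {W : List (Slice T)}
    {b : List Q} (C : TangleColoring A W b m) (C' : TangleColoring A W' m e) :
    (C.append C').weight φ = C.weight φ * C'.weight φ := by
  induction C with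
  | nil b => exact (one_mul _).symm
  | cons h C ih => simp only [append, weight, ih C', mul_assoc]

/-- The weights of a stack of two tangles are obtained by summation over the colours in between. -/
theorem sameWeights_append (W W' : List (Slice T)) (b c : List Q) :
    SameWeights (weights A φ (W ++ W') b c)
      (fun p : Σ m, TangleColoring A W b m × TangleColoring A W' m c =>
        weights A φ W b p.1 p.2.1 * weights A φ W' p.1 c p.2.2) := by
  refine SameWeights.symm ⟨⟨fun p => p.2.1.append p.2.2, TangleColoring.split W, ?_,
    TangleColoring.append_split W⟩, ?_⟩
  · rintro ⟨m, C, C'⟩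
    exact C.split_append C'
  · rintro ⟨m, C, C'⟩
    exact C.weight_append C'

theorem nonempty_append_iff {W W' : List (Slice T)} {b c : List Q} :
    Nonempty (TangleColoring A (W ++ W') b c) ↔
      ∃ m, Nonempty (TangleColoring A W b m) ∧ Nonempty (TangleColoring A W' m c) := by
  constructor
  · rintro ⟨C⟩
    exact ⟨_, ⟨(C.split W).2.1⟩, ⟨(C.split W).2.2⟩⟩
  · rintro ⟨m, ⟨C⟩, ⟨C'⟩⟩
    exact ⟨C.append C'⟩

theorem SameWeights.append {W₁ W₁' W₂ W₂' : List (Slice T)} {b c : List Q}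
    (h₁ : ∀ m, SameWeights (weights A φ W₁ b m) (weights A φ W₁' b m))
    (h₂ : ∀ m, Nonempty (TangleColoring A W₁ b m) →
      SameWeights (weights A φ W₂ m c) (weights A φ W₂' m c)) :
    SameWeights (weights A φ (W₁ ++ W₂) b c) (weights A φ (W₁' ++ W₂') b c) := by
  refine (sameWeights_append _ _ _ _).trans (SameWeights.trans ?_ (sameWeights_append _ _ _ _).symm)
  refine SameWeights.sigma_right
    (f := fun m (p : TangleColoring A W₁ b m × TangleColoring A W₂ m c) =>
      weights A φ W₁ b m p.1 * weights A φ W₂ m c p.2)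
    (g := fun m (p : TangleColoring A W₁' b m × TangleColoring A W₂' m c) =>
      weights A φ W₁' b m p.1 * weights A φ W₂' m c p.2) fun m => ?_
  rcases isEmpty_or_nonempty (TangleColoring A W₁ b m) with hE | hE
  · obtain ⟨e, -⟩ := h₁ m
    have := e.symm.isEmpty
    exact SameWeights.of_isEmpty _ _
  · exact (h₁ m).mul (h₂ m hE)

/-- If `W` has a single coloring of weight `1` above `b`, ending in `m`, then a coloring of
`W ++ W'` is a coloring of `W'` above `m`. -/
theorem sameWeights_append_of_unique_left {W W' : List (Slice T)} {b m c : List Q}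
    (h : ∀ n, SameWeights (weights A φ W b n) (fun _ : PLift (n = m) => (1 : G))) :
    SameWeights (weights A φ (W ++ W') b c) (weights A φ W' m c) := by
  refine (sameWeights_append _ _ _ _).trans ?_
  refine (SameWeights.sigma_right
    (f := fun n (p : TangleColoring A W b n × TangleColoring A W' n c) =>
      weights A φ W b n p.1 * weights A φ W' n c p.2)
    (g := fun n (p : PLift (n = m) × TangleColoring A W' n c) => 1 * weights A φ W' n c p.2)
    fun n => (h n).mul (SameWeights.refl _)).trans ?_
  refine SameWeights.symm ⟨⟨fun C => ⟨m, ⟨rfl⟩, C⟩, fun p => p.2.1.down ▸ p.2.2, ?_, ?_⟩, ?_⟩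
  · intro C; rfl
  · rintro ⟨n, ⟨rfl⟩, C⟩; rfl
  · intro C; exact one_mul _

/-- If `W'` has a single coloring of weight `1` below `c`, beginning with `m`, then a coloring of
`W ++ W'` is a coloring of `W` below `m`. -/
theorem sameWeights_append_of_unique_right {W W' : List (Slice T)} {b m c : List Q}
    (h : ∀ n, Nonempty (TangleColoring A W b n) →
      SameWeights (weights A φ W' n c) (fun _ : PLift (n = m) => (1 : G))) :
    SameWeights (weights A φ (W ++ W') b c) (weights A φ W b m) := by
  refine (sameWeights_append _ _ _ _).trans ?_
  refine (SameWeights.sigma_right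
    (f := fun n (p : TangleColoring A W b n × TangleColoring A W' n c) =>
      weights A φ W b n p.1 * weights A φ W' n c p.2)
    (g := fun n (p : TangleColoring A W b n × PLift (n = m)) => weights A φ W b n p.1 * 1)
    fun n => ?_).trans ?_
  · rcases isEmpty_or_nonempty (TangleColoring A W b n) with hE | hE
    · exact SameWeights.of_isEmpty _ _
    · exact (SameWeights.refl _).mul (h n hE)
  · refine SameWeights.symm ⟨⟨fun C => ⟨m, C, ⟨rfl⟩⟩, fun p => p.2.2.down ▸ p.2.1, ?_, ?_⟩, ?_⟩
    · intro C; rfl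
    · rintro ⟨n, C, ⟨rfl⟩⟩; rfl
    · intro C; exact mul_one _

/-! ### Rules and weights of strips -/

theorem genRule_cup {d : Dir} {b c : List Q} :
    GenRule A (.cup d) b c ↔ ∃ x, b = [] ∧ c = [x, x] := by
  constructor
  · intro h
    rcases b with _ | ⟨_, _⟩ <;> rcases c with _ | ⟨x, _ | ⟨y, _ | ⟨z, c⟩⟩⟩ <;>
      first | exact False.elim h | exact ⟨x, rfl, by rw [show x = y from h]⟩
  · rintro ⟨x, rfl, rfl⟩
    rfl

theorem genRule_cap {d : Dir} {b c : List Q} :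
    GenRule A (.cap d) b c ↔ ∃ x, b = [x, x] ∧ c = [] := by
  constructor
  · intro h
    rcases c with _ | ⟨_, _⟩ <;> rcases b with _ | ⟨x, _ | ⟨y, _ | ⟨z, b⟩⟩⟩ <;>
      first | exact False.elim h | exact ⟨x, by rw [show x = y from h], rfl⟩
  · rintro ⟨x, rfl, rfl⟩
    rfl

theorem genRule_cross {k : Kind T} {d₁ d₂ : Dir} {b c : List Q} :
    GenRule A (.cross k d₁ d₂) b c ↔ ∃ x₁ x₂ y₂ y₁, b = [x₁, x₂] ∧ c = [y₂, y₁] ∧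
      CrossRule A k d₁ d₂ x₁ x₂ y₂ y₁ := by
  constructor
  · intro h
    rcases b with _ | ⟨x₁, _ | ⟨x₂, _ | ⟨_, b⟩⟩⟩ <;>
      rcases c with _ | ⟨y₂, _ | ⟨y₁, _ | ⟨_, c⟩⟩⟩ <;>
      first | exact False.elim h | exact ⟨x₁, x₂, y₂, y₁, rfl, rfl, h⟩
  · rintro ⟨x₁, x₂, y₂, y₁, rfl, rfl, h⟩
    exact h

theorem GenRule.length_src {g : Gen T} {b c : List Q} (h : GenRule A g b c) :
    b.length = g.src.length := by
  cases g <;> simp only [genRule_cup, genRule_cap, genRule_cross] at h <;> grind [Gen.src]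

theorem GenRule.length_tgt {g : Gen T} {b c : List Q} (h : GenRule A g b c) :
    c.length = g.tgt.length := by
  cases g <;> simp only [genRule_cup, genRule_cap, genRule_cross] at h <;> grind [Gen.tgt]

theorem SliceRule.length_tgt {s : Slice T} {b c : List Q} (h : SliceRule A s b c) :
    c.length = s.tgt.length := by
  obtain ⟨l, r, b', c', hl, hr, rfl, rfl, hg⟩ := h
  simp [Slice.tgt, hl, hr, hg.length_tgt]

theorem sliceWeight_eq {s : Slice T} {l r b c : List Q} (hl : l.length = s.left.length)
    (hg : GenRule A s.gen b c) :
    sliceWeight φ s (l ++ b ++ r) (l ++ c ++ r) = genWeight φ s.gen b c := by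
  unfold sliceWeight
  rw [← hl, ← hg.length_src, ← hg.length_tgt]
  simp

theorem TangleColoring.length_eq {m n : List Dir} {W : List (Slice T)} {b c : List Q}
    (C : TangleColoring A W b c) (hW : IsTangle m W n) (hb : b.length = m.length) :
    c.length = n.length := by
  induction C generalizing m with
  | nil b => rw [hb, show m = n from hW]
  | cons h C ih => exact ih hW.2 h.length_tgt

/-! ### Maps of colorings -/

section Transport

variable {F : List Q → List Q} {σ : Slice T → Slice T}

/-- An injection `F` of boundary colorings that is compatible with the rules and the weights under
a modification `σ` of the strips induces a bijection of colorings. -/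
theorem sameWeights_map (hF : Function.Injective F)
    (hrule : ∀ s b c', SliceRule A (σ s) (F b) c' ↔ ∃ c, F c = c' ∧ SliceRule A s b c)
    (hweight : ∀ s b c, SliceRule A s b c →
      sliceWeight φ (σ s) (F b) (F c) = sliceWeight φ s b c)
    (W : List (Slice T)) (b c : List Q) :
    SameWeights (weights A φ W b c) (weights A φ (W.map σ) (F b) (F c)) := by
  induction W generalizing b with
  | nil =>
    rw [List.map_nil]
    refine SameWeights.of_subsingleton fun a => ?_
    rw [exists_weights_nil, exists_weights_nil, hF.eq_iff]
  | cons s W ih =>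
    refine (sameWeights_cons _ _ _ _).trans (SameWeights.trans ?_ (sameWeights_cons _ _ _ _).symm)
    have hmem : ∀ m : {m // SliceRule A s b m}, SliceRule A (σ s) (F b) (F m) :=
      fun m => (hrule _ _ _).2 ⟨m, rfl, m.2⟩
    let e : {m // SliceRule A s b m} ≃ {m // SliceRule A (σ s) (F b) m} :=
      Equiv.ofBijective (fun m => ⟨F m, hmem m⟩)
        ⟨fun m m' h => Subtype.ext (hF (congrArg Subtype.val h)), fun ⟨m', h⟩ => by
          obtain ⟨m, rfl, hm⟩ := (hrule _ _ _).1 h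
          exact ⟨⟨m, hm⟩, rfl⟩⟩
    have he : ∀ m, (e m : List Q) = F m := fun m => rfl
    refine SameWeights.sigma
      (f := fun (m : {m // SliceRule A s b m}) (C : TangleColoring A W m c) =>
        sliceWeight φ s b m * weights A φ W m c C)
      (g := fun (m : {m // SliceRule A (σ s) (F b) m}) (C : TangleColoring A (W.map σ) m (F c)) =>
        sliceWeight φ (σ s) (F b) m * weights A φ (W.map σ) m (F c) C) e fun m => ?_
    rw [he, hweight s b m m.2]
    exact (ih m).mul_left _

theorem exists_eq_of_nonempty_map
    (hrule : ∀ s b c', SliceRule A (σ s) (F b) c' ↔ ∃ c, F c = c' ∧ SliceRule A s b c)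
    {W : List (Slice T)} {b c' : List Q} (h : Nonempty (TangleColoring A (W.map σ) (F b) c')) :
    ∃ c, F c = c' ∧ Nonempty (TangleColoring A W b c) := by
  induction W generalizing b with
  | nil => exact ⟨b, nonempty_nil_iff.1 h, ⟨.nil b⟩⟩
  | cons s W ih =>
    obtain ⟨m', hs, hC⟩ := nonempty_cons_iff.1 h
    obtain ⟨m, rfl, hm⟩ := (hrule _ _ _).1 hs
    obtain ⟨c, hc, hC'⟩ := ih hC
    exact ⟨c, hc, nonempty_cons_iff.2 ⟨m, hm, hC'⟩⟩

end Transport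

section Whisker

variable {L R : List Dir} {l r : List Q}

theorem sliceRule_whisker (hl : l.length = L.length) (hr : r.length = R.length) (s : Slice T)
    (b c' : List Q) :
    SliceRule A ⟨L ++ s.left, s.gen, s.right ++ R⟩ (l ++ b ++ r) c' ↔
      ∃ c, l ++ c ++ r = c' ∧ SliceRule A s b c := by
  constructor
  · rintro ⟨l₁, r₁, b₁, c₁, hl₁, hr₁, hb, rfl, hg⟩
    have hlen := congrArg List.length hb
    simp only [List.length_append] at hl₁ hr₁ hlen
    obtain ⟨l₂, l₃, rfl, hl₂⟩ : ∃ l₂ l₃, l₁ = l₂ ++ l₃ ∧ l₂.length = l.length :=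
      ⟨l₁.take l.length, l₁.drop l.length, (List.take_append_drop _ _).symm,
        by rw [List.length_take]; omega⟩
    obtain ⟨r₂, r₃, rfl, hr₂⟩ : ∃ r₂ r₃, r₁ = r₂ ++ r₃ ∧ r₂.length = s.right.length :=
      ⟨r₁.take s.right.length, r₁.drop s.right.length, (List.take_append_drop _ _).symm,
        by rw [List.length_take]; omega⟩
    simp only [List.append_assoc] at hb
    obtain ⟨rfl, hb'⟩ := List.append_inj hb hl₂.symm
    simp only [List.length_append] at hl₁ hr₁ hlen
    obtain ⟨rfl, rfl⟩ := List.append_inj' (s₂ := l₃ ++ b₁ ++ r₂) (t₂ := r₃) (hb'.trans (by simp))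
      (by omega)
    refine ⟨l₃ ++ c₁ ++ r₂, by simp, l₃, r₂, b₁, c₁, by omega, hr₂, rfl, rfl, hg⟩
  · rintro ⟨c, rfl, l₁, r₁, b₁, c₁, hl₁, hr₁, rfl, rfl, hg⟩
    exact ⟨l ++ l₁, r₁ ++ r, b₁, c₁, by simp [hl, hl₁], by simp [hr, hr₁], by simp, by simp, hg⟩

theorem sliceWeight_whisker (hl : l.length = L.length) (s : Slice T)
    (b c : List Q) (h : SliceRule A s b c) :
    sliceWeight φ ⟨L ++ s.left, s.gen, s.right ++ R⟩ (l ++ b ++ r) (l ++ c ++ r) =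
      sliceWeight φ s b c := by
  obtain ⟨l₁, r₁, b₁, c₁, hl₁, hr₁, rfl, rfl, hg⟩ := h
  rw [sliceWeight_eq hl₁ hg]
  have := sliceWeight_eq (φ := φ) (s := ⟨L ++ s.left, s.gen, s.right ++ R⟩) (l := l ++ l₁)
    (r := r₁ ++ r) (by simp [hl, hl₁]) hg
  simpa using this

theorem sameWeights_whisker (hl : l.length = L.length) (hr : r.length = R.length)
    (W : List (Slice T)) (b c : List Q) :
    SameWeights (weights A φ W b c) (weights A φ (whisker L R W) (l ++ b ++ r) (l ++ c ++ r)) :=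
  sameWeights_map (F := fun b => l ++ b ++ r)
    (fun _ _ h => List.append_cancel_left (List.append_cancel_right h))
    (sliceRule_whisker hl hr) (sliceWeight_whisker hl) W b c

theorem exists_eq_of_nonempty_whisker (hl : l.length = L.length) (hr : r.length = R.length)
    {W : List (Slice T)} {b c' : List Q}
    (h : Nonempty (TangleColoring A (whisker L R W) (l ++ b ++ r) c')) :
    ∃ c, l ++ c ++ r = c' ∧ Nonempty (TangleColoring A W b c) :=
  exists_eq_of_nonempty_map (F := fun b => l ++ b ++ r) (sliceRule_whisker hl hr) h

end Whisker

end Colorings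

/-! ### Weights of elementary strips -/

section Weights

variable {T : Type u} {Q : Type v} {G : Type w} [CommGroup G] {φ : Q → Q → G}

theorem genWeight_virtual {t : T} {d₁ d₂ : Dir} {b c : List Q} :
    genWeight φ (.cross (.virtual t) d₁ d₂) b c = 1 := by
  simp [genWeight]

theorem genWeight_cup {d : Dir} {b c : List Q} : genWeight φ (.cup d : Gen T) b c = 1 := by
  simp [genWeight]

theorem genWeight_cap {d : Dir} {b c : List Q} : genWeight φ (.cap d : Gen T) b c = 1 := by
  simp [genWeight]

theorem sliceWeight_cup {L R : List Dir} {d : Dir} {b c : List Q} :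
    sliceWeight φ (⟨L, .cup d, R⟩ : Slice T) b c = 1 :=
  genWeight_cup

theorem sliceWeight_cap {L R : List Dir} {d : Dir} {b c : List Q} :
    sliceWeight φ (⟨L, .cap d, R⟩ : Slice T) b c = 1 :=
  genWeight_cap

theorem sliceWeight_virtual {L R : List Dir} {t : T} {d₁ d₂ : Dir} {b c : List Q} :
    sliceWeight φ ⟨L, .cross (.virtual t) d₁ d₂, R⟩ b c = 1 :=
  genWeight_virtual

theorem sliceWeight_cross {L R : List Dir} {k : Kind T} {d₁ d₂ : Dir} {l r : List Q}
    {x₁ x₂ y₂ y₁ : Q} (hl : l.length = L.length) :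
    sliceWeight φ ⟨L, .cross k d₁ d₂, R⟩ (l ++ x₁ :: x₂ :: r) (l ++ y₂ :: y₁ :: r) =
      genWeight φ (.cross k d₁ d₂) [x₁, x₂] [y₂, y₁] := by
  simp [sliceWeight, ← hl, Gen.src, Gen.tgt]

theorem sliceWeight_cross_nil {R : List Dir} {k : Kind T} {d₁ d₂ : Dir} {x₁ x₂ y₂ y₁ : Q}
    {r : List Q} :
    sliceWeight φ ⟨[], .cross k d₁ d₂, R⟩ (x₁ :: x₂ :: r) (y₂ :: y₁ :: r) =
      genWeight φ (.cross k d₁ d₂) [x₁, x₂] [y₂, y₁] :=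
  sliceWeight_cross (l := []) rfl

theorem sliceWeight_cross_one {e : Dir} {R : List Dir} {k : Kind T} {d₁ d₂ : Dir}
    {x₁ x₂ y₂ y₁ z : Q} {r : List Q} :
    sliceWeight φ ⟨[e], .cross k d₁ d₂, R⟩ (z :: x₁ :: x₂ :: r) (z :: y₂ :: y₁ :: r) =
      genWeight φ (.cross k d₁ d₂) [x₁, x₂] [y₂, y₁] :=
  sliceWeight_cross (l := [z]) rfl

end Weights

section Crossings

variable {T : Type u} {Q : Type v} [Quandle Q] {G : Type w} [CommGroup G]
  {A : Operators T Q} {φ : Q → Q → G}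

/-! ### Crossings as permutations of colours -/

/-- The exponent of a direction, `1` for upward and `-1` for downward. -/
def Dir.sign : Dir → ℤ
  | .up => 1
  | .down => -1

theorem Dir.sign_flip (d : Dir) : d.flip.sign = -d.sign := by
  cases d <;> rfl

theorem Dir.flip_flip (d : Dir) : d.flip.flip = d := by
  cases d <;> rfl

theorem Kind.flip_flip (k : Kind T) : k.flip.flip = k := by
  rcases k with o | t
  · exact congrArg Kind.classical (Bool.not_not o)
  · rfl

/-- The effect on the colour of a strand that passes from bottom right to top left under a strand of
direction `d` and colour `z`. -/
def under (d : Dir) (z : Q) : Equiv.Perm Q := Rack.act' z ^ d.sign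

theorem under_up (z x : Q) : under .up z x = z ◃ x := rfl

theorem under_down (z x : Q) : under .down z x = z ◃⁻¹ x := rfl

theorem under_flip (d : Dir) (z : Q) : under d.flip z = (under d z)⁻¹ := by
  rw [under, under, Dir.sign_flip, zpow_neg]

theorem under_flip_apply (d : Dir) (z x : Q) : under d.flip z (under d z x) = x := by
  rw [under_flip]
  exact (under d z).symm_apply_apply x

theorem under_apply_flip (d : Dir) (z x : Q) : under d z (under d.flip z x) = x := by
  rw [under_flip]
  exact (under d z).apply_symm_apply x

theorem under_self (d : Dir) (z : Q) : under d z z = z := by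
  cases d
  · exact Quandle.fix
  · exact Quandle.fix_inv

/-- The weight of a crossing at which an upward strand of colour `x` passes from bottom right to top
left under a strand of direction `d` and colour `z`. -/
def underPhi (φ : Q → Q → G) (d : Dir) (z x : Q) : G :=
  match d with
  | .up => φ x z
  | .down => (φ (z ◃⁻¹ x) z)⁻¹

theorem underPhi_flip (d : Dir) (z x : Q) :
    underPhi φ d.flip z (under d z x) = (underPhi φ d z x)⁻¹ := by
  cases d
  · simp [underPhi, Dir.flip, under_up]
  · simp [underPhi, Dir.flip, under_down]

theorem underPhi_self (hφ : IsOperatorCocycle A φ) (d : Dir) (z : Q) : underPhi φ d z z = 1 := by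
  cases d
  · exact hφ.self z
  · simp [underPhi, Quandle.fix_inv, hφ.self]

/-- From bottom to top, the colour of a strand at a virtual crossing changes by a power of the
operator that depends only on the direction of the other strand. -/
theorem crossRule_virtual {t : T} {d₁ d₂ : Dir} {x₁ x₂ y₂ y₁ : Q} :
    CrossRule A (.virtual t) d₁ d₂ x₁ x₂ y₂ y₁ ↔
      y₂ = (A.op t ^ d₁.sign) x₂ ∧ y₁ = (A.op t ^ d₂.flip.sign) x₁ := by
  cases d₁ <;> cases d₂ <;>
    simp [CrossRule, Dir.incoming, Dir.outgoing, Dir.sign, Dir.flip] <;>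
    grind [Equiv.symm_apply_apply, Equiv.apply_symm_apply]

/-- From bottom to top, the colour of the under-strand changes in a way that depends only on the
direction and the colour of the over-strand. -/
theorem crossRule_over {d₁ d₂ : Dir} {x₁ x₂ y₂ y₁ : Q} :
    CrossRule A (.classical true) d₁ d₂ x₁ x₂ y₂ y₁ ↔ y₁ = x₁ ∧ y₂ = under d₁ x₁ x₂ := by
  cases d₁ <;> cases d₂ <;>
    simp only [CrossRule, UnderRule, isPositive, Dir.incoming, Dir.outgoing, under_up,
      under_down] <;>
    simp <;> grind [Rack.left_inv, Rack.right_inv]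

/-- The under-strand runs from bottom left to top right here, hence the reversed direction of the
over-strand. -/
theorem crossRule_under {d₁ d₂ : Dir} {x₁ x₂ y₂ y₁ : Q} :
    CrossRule A (.classical false) d₁ d₂ x₁ x₂ y₂ y₁ ↔
      y₂ = x₂ ∧ y₁ = under d₂.flip x₂ x₁ := by
  cases d₁ <;> cases d₂ <;>
    simp only [CrossRule, UnderRule, isPositive, Dir.incoming, Dir.outgoing, Dir.flip, under_up,
      under_down] <;>
    simp <;> grind [Rack.left_inv, Rack.right_inv]

theorem genWeight_over {d₁ d₂ : Dir} {x₁ x₂ y₁ : Q} :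
    genWeight φ (.cross (.classical true : Kind T) d₁ d₂) [x₁, x₂] [under d₁ x₁ x₂, y₁] =
      underPhi φ d₁ x₁ x₂ ^ d₂.sign := by
  cases d₁ <;> cases d₂ <;>
    simp [genWeight, underWeight, underPhi, isPositive, Dir.incoming, Dir.outgoing, Dir.sign,
      under_down]

theorem genWeight_under {d₁ d₂ : Dir} {x₁ x₂ y₂ : Q} :
    genWeight φ (.cross (.classical false : Kind T) d₁ d₂) [x₁, x₂] [y₂, under d₂.flip x₂ x₁] =
      underPhi φ d₂.flip x₂ x₁ ^ d₁.sign := by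
  cases d₁ <;> cases d₂ <;>
    simp [genWeight, underWeight, underPhi, isPositive, Dir.incoming, Dir.outgoing, Dir.sign,
      Dir.flip, under_down]

theorem act'_under (d : Dir) (t m : Q) :
    Rack.act' (under d t m) = under d t * Rack.act' m * (under d t)⁻¹ := by
  cases d
  · exact Rack.ad_conj t m
  · have h := Rack.ad_conj t (t ◃⁻¹ m)
    rw [Rack.right_inv] at h
    rw [under_down, h, show under .down t = (Rack.act' t)⁻¹ from zpow_neg_one _]
    group

/-- The colours of a strand that passes under two others do not depend on the order of the two
crossings, the colour of the middle strand being changed by the top strand. -/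
theorem under_under (dm dt : Dir) (m t x : Q) :
    under dm (under dt t m) (under dt t x) = under dt t (under dm m x) := by
  have h : under dm (under dt t m) = under dt t * under dm m * (under dt t)⁻¹ := by
    rw [under, act'_under, conj_zpow, ← under]
  rw [h, Equiv.Perm.mul_apply, Equiv.Perm.mul_apply]
  exact congrArg _ (congrArg _ ((under dt t).symm_apply_apply x))

/-- The cocycle condition for all orientations of the two upper strands: a strand of colour `x`
passes under strands of colours `m` and `t` in either order. -/
theorem underPhi_cocycle (hφ : IsOperatorCocycle A φ) (dm dt : Dir) (m t x : Q) :
    underPhi φ dm m x * underPhi φ dt t (under dm m x) =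
      underPhi φ dt t x * underPhi φ dm (under dt t m) (under dt t x) := by
  have hup : ∀ m t x : Q, underPhi φ .up m x * underPhi φ .up t (under .up m x) =
      underPhi φ .up t x * underPhi φ .up (under .up t m) (under .up t x) :=
    fun m t x => hφ.cocycle x m t
  -- A downward strand is replaced by an upward one, the arc of the lowest strand on its other side
  -- being taken as the initial one.
  have hm : ∀ (dt : Dir) (m t x : Q), underPhi φ .up m x * underPhi φ dt t (under .up m x) =
      underPhi φ dt t x * underPhi φ .up (under dt t m) (under dt t x) := by
    rintro (_ | _) m t x
    · exact hup m t x
    · obtain ⟨m, rfl⟩ := (under .up t).surjective m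
      obtain ⟨x, rfl⟩ := (under .up t).surjective x
      have h₁ : underPhi φ .down t (under .up t x) = (underPhi φ .up t x)⁻¹ :=
        underPhi_flip .up t x
      have h₂ : underPhi φ .down t (under .up t (under .up m x)) =
          (underPhi φ .up t (under .up m x))⁻¹ := underPhi_flip .up t _
      have h₃ : ∀ z, under .down t (under .up t z) = z := under_flip_apply .up t
      rw [under_under, h₁, h₂, h₃, h₃, mul_inv_eq_iff_eq_mul, mul_assoc, hup, inv_mul_cancel_left]
  cases dm
  · exact hm dt m t x
  · obtain ⟨x, rfl⟩ := (under .up m).surjective x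
    have h₁ : underPhi φ .down m (under .up m x) = (underPhi φ .up m x)⁻¹ :=
      underPhi_flip .up m x
    have h₂ : underPhi φ .down (under dt t m) (under .up (under dt t m) (under dt t x)) =
        (underPhi φ .up (under dt t m) (under dt t x))⁻¹ := underPhi_flip .up _ _
    have h₃ : under .down m (under .up m x) = x := under_flip_apply .up m x
    rw [h₁, h₃, ← under_under .up, h₂, inv_mul_eq_iff_eq_mul, ← mul_assoc, hm,
      mul_inv_cancel_right]

/-! ### Strips with given vertical strands -/

theorem sliceRule_cup {L R : List Dir} {d : Dir} {b c : List Q} :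
    SliceRule A ⟨L, .cup d, R⟩ b c ↔ ∃ l r x, l.length = L.length ∧ r.length = R.length ∧
      b = l ++ r ∧ c = l ++ x :: x :: r := by
  simp only [SliceRule, genRule_cup]
  constructor
  · rintro ⟨l, r, _, _, hl, hr, rfl, rfl, x, rfl, rfl⟩
    exact ⟨l, r, x, hl, hr, by simp, by simp⟩
  · rintro ⟨l, r, x, hl, hr, rfl, rfl⟩
    exact ⟨l, r, _, _, hl, hr, by simp, by simp, x, rfl, rfl⟩

theorem sliceRule_cap {L R : List Dir} {d : Dir} {b c : List Q} :
    SliceRule A ⟨L, .cap d, R⟩ b c ↔ ∃ l r x, l.length = L.length ∧ r.length = R.length ∧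
      b = l ++ x :: x :: r ∧ c = l ++ r := by
  simp only [SliceRule, genRule_cap]
  constructor
  · rintro ⟨l, r, _, _, hl, hr, rfl, rfl, x, rfl, rfl⟩
    exact ⟨l, r, x, hl, hr, by simp, by simp⟩
  · rintro ⟨l, r, x, hl, hr, rfl, rfl⟩
    exact ⟨l, r, _, _, hl, hr, by simp, by simp, x, rfl, rfl⟩

theorem sliceRule_cross {L R : List Dir} {k : Kind T} {d₁ d₂ : Dir} {b c : List Q} :
    SliceRule A ⟨L, .cross k d₁ d₂, R⟩ b c ↔ ∃ l r x₁ x₂ y₂ y₁,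
      l.length = L.length ∧ r.length = R.length ∧ b = l ++ x₁ :: x₂ :: r ∧
        c = l ++ y₂ :: y₁ :: r ∧ CrossRule A k d₁ d₂ x₁ x₂ y₂ y₁ := by
  simp only [SliceRule, genRule_cross]
  constructor
  · rintro ⟨l, r, _, _, hl, hr, rfl, rfl, x₁, x₂, y₂, y₁, rfl, rfl, h⟩
    exact ⟨l, r, x₁, x₂, y₂, y₁, hl, hr, by simp, by simp, h⟩
  · rintro ⟨l, r, x₁, x₂, y₂, y₁, hl, hr, rfl, rfl, h⟩
    exact ⟨l, r, _, _, hl, hr, by simp, by simp, x₁, x₂, y₂, y₁, rfl, rfl, h⟩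

end Crossings

section LocalMoves

variable {T : Type u} {Q : Type v} [Quandle Q] {G : Type w} [CommGroup G]
  {A : Operators T Q} {φ : Q → Q → G}

/-! ### Tangles with few strips -/

theorem exists_weights_pair {s s' : Slice T} {b c : List Q} {a : G} :
    (∃ C, weights A φ [s, s'] b c C = a) ↔ ∃ m, SliceRule A s b m ∧ SliceRule A s' m c ∧
      sliceWeight φ s b m * sliceWeight φ s' m c = a := by
  constructor
  · rintro ⟨_ | ⟨h, _ | ⟨h', _ | _⟩⟩, hC⟩
    exact ⟨_, h, h', by rw [← hC, weights]; simp [TangleColoring.weight]⟩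
  · rintro ⟨m, h, h', rfl⟩
    exact ⟨.cons h (.cons h' (.nil _)), by simp [weights, TangleColoring.weight]⟩

theorem exists_weights_triple {s s' s'' : Slice T} {b c : List Q} {a : G} :
    (∃ C, weights A φ [s, s', s''] b c C = a) ↔ ∃ m n, SliceRule A s b m ∧ SliceRule A s' m n ∧
      SliceRule A s'' n c ∧
        sliceWeight φ s b m * (sliceWeight φ s' m n * sliceWeight φ s'' n c) = a := by
  constructor
  · rintro ⟨_ | ⟨h, _ | ⟨h', _ | ⟨h'', _ | _⟩⟩⟩, hC⟩
    exact ⟨_, _, h, h', h'', by rw [← hC, weights]; simp [TangleColoring.weight]⟩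
  · rintro ⟨m, n, h, h', h'', rfl⟩
    exact ⟨.cons h (.cons h' (.cons h'' (.nil _))), by simp [weights, TangleColoring.weight]⟩

theorem subsingleton_pair {s s' : Slice T} {b c : List Q}
    (h : ∀ m m', SliceRule A s b m → SliceRule A s' m c → SliceRule A s b m' →
      SliceRule A s' m' c → m = m') :
    Subsingleton (TangleColoring A [s, s'] b c) := by
  refine ⟨?_⟩
  rintro (_ | ⟨h₁, _ | ⟨h₂, _ | _⟩⟩) (_ | ⟨h₁', _ | ⟨h₂', _ | _⟩⟩)
  obtain rfl := h _ _ h₁ h₂ h₁' h₂'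
  rfl

theorem subsingleton_triple {s s' s'' : Slice T} {b c : List Q}
    (h : ∀ m m' n n', SliceRule A s b m → SliceRule A s' m n → SliceRule A s'' n c →
      SliceRule A s b m' → SliceRule A s' m' n' → SliceRule A s'' n' c → m = m' ∧ n = n') :
    Subsingleton (TangleColoring A [s, s', s''] b c) := by
  refine ⟨?_⟩
  rintro (_ | ⟨h₁, _ | ⟨h₂, _ | ⟨h₃, _ | _⟩⟩⟩) (_ | ⟨h₁', _ | ⟨h₂', _ | ⟨h₃', _ | _⟩⟩⟩)
  obtain ⟨rfl, rfl⟩ := h _ _ _ _ h₁ h₂ h₃ h₁' h₂' h₃'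
  rfl

/-- A replacement of one part of a diagram by another one that induces, for all possible colours on
the boundary, a weight-preserving bijection of colorings. In `TangleColoring` the boundary colours
of the empty tangle are of any length, so the length is prescribed by the lowest strip of `X`. -/
def IsColorInvariant (A : Operators T Q) (φ : Q → Q → G) (X X' : List (Slice T)) : Prop :=
  X = X' ∨ ∃ s W, X = s :: W ∧ ∀ b c : List Q, b.length = s.src.length →
    SameWeights (weights A φ X b c) (weights A φ X' b c)

/-! ### Exchange of heights -/

theorem sliceRule_exchange_left {g h : Gen T} {M : List Dir} {b m c : List Q} :
    SliceRule A ⟨[], g, M ++ h.src⟩ b m ∧ SliceRule A ⟨g.tgt ++ M, h, []⟩ m c ↔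
      ∃ b₁ k b₂ c₁ c₂, k.length = M.length ∧ GenRule A g b₁ c₁ ∧ GenRule A h b₂ c₂ ∧
        b = b₁ ++ k ++ b₂ ∧ m = c₁ ++ k ++ b₂ ∧ c = c₁ ++ k ++ c₂ := by
  constructor
  · rintro ⟨⟨l, r, b₁, c₁, hl, hr, rfl, rfl, hg⟩, l', r', b₂, c₂, hl', hr', hm, rfl, hh⟩
    obtain rfl := List.length_eq_zero_iff.1 hl
    obtain rfl := List.length_eq_zero_iff.1 hr'
    have hg' := hg.length_tgt
    have hh' := hh.length_src
    simp only [List.length_append, List.nil_append, List.append_nil] at hg' hh' hr hl' hm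
    obtain ⟨l₁, k, rfl, hl₁⟩ : ∃ l₁ k, l' = l₁ ++ k ∧ l₁.length = c₁.length :=
      ⟨l'.take c₁.length, l'.drop c₁.length, (List.take_append_drop _ _).symm,
        by rw [List.length_take]; omega⟩
    rw [List.append_assoc] at hm
    obtain ⟨rfl, rfl⟩ := List.append_inj hm hl₁.symm
    refine ⟨b₁, k, b₂, c₁, c₂, ?_, hg, hh, by simp, by simp, by simp⟩
    rw [List.length_append] at hr
    omega
  · rintro ⟨b₁, k, b₂, c₁, c₂, hk, hg, hh, rfl, rfl, rfl⟩
    exact ⟨⟨[], k ++ b₂, b₁, c₁, rfl, by simp [hk, hh.length_src], by simp, by simp, hg⟩,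
      c₁ ++ k, [], b₂, c₂, by simp [hk, hg.length_tgt], rfl, by simp, by simp, hh⟩

theorem sliceRule_exchange_right {g h : Gen T} {M : List Dir} {b m c : List Q} :
    SliceRule A ⟨g.src ++ M, h, []⟩ b m ∧ SliceRule A ⟨[], g, M ++ h.tgt⟩ m c ↔
      ∃ b₁ k b₂ c₁ c₂, k.length = M.length ∧ GenRule A g b₁ c₁ ∧ GenRule A h b₂ c₂ ∧
        b = b₁ ++ k ++ b₂ ∧ m = b₁ ++ k ++ c₂ ∧ c = c₁ ++ k ++ c₂ := by
  constructor
  · rintro ⟨⟨l', r', b₂, c₂, hl', hr', rfl, rfl, hh⟩, l, r, b₁, c₁, hl, hr, hm, rfl, hg⟩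
    obtain rfl := List.length_eq_zero_iff.1 hl
    obtain rfl := List.length_eq_zero_iff.1 hr'
    have hg' := hg.length_src
    have hh' := hh.length_tgt
    simp only [List.length_append, List.nil_append, List.append_nil] at hg' hh' hr hl' hm
    obtain ⟨l₁, k, rfl, hl₁⟩ : ∃ l₁ k, l' = l₁ ++ k ∧ l₁.length = b₁.length :=
      ⟨l'.take b₁.length, l'.drop b₁.length, (List.take_append_drop _ _).symm,
        by rw [List.length_take]; omega⟩
    rw [List.append_assoc] at hm
    obtain ⟨rfl, rfl⟩ := List.append_inj hm hl₁
    refine ⟨l₁, k, b₂, c₁, c₂, ?_, hg, hh, by simp, by simp, by simp⟩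
    rw [List.length_append] at hr
    omega
  · rintro ⟨b₁, k, b₂, c₁, c₂, hk, hg, hh, rfl, rfl, rfl⟩
    exact ⟨⟨b₁ ++ k, [], b₂, c₂, by simp [hk, hg.length_src], rfl, by simp, by simp, hh⟩,
      [], k ++ c₂, b₁, c₁, rfl, by simp [hk, hh.length_tgt], by simp, by simp, hg⟩

theorem GenRule.append_inj {g h : Gen T} {b₁ b₁' b₂ b₂' c₁ c₁' c₂ c₂' k k' : List Q}
    (hg : GenRule A g b₁ c₁) (hg' : GenRule A g b₁' c₁') (hh : GenRule A h b₂ c₂)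
    (hh' : GenRule A h b₂' c₂') (hb : b₁ ++ k ++ b₂ = b₁' ++ k' ++ b₂')
    (hc : c₁ ++ k ++ c₂ = c₁' ++ k' ++ c₂') :
    b₁ = b₁' ∧ k = k' ∧ b₂ = b₂' ∧ c₁ = c₁' ∧ c₂ = c₂' := by
  have h₁ := hg.length_src.trans hg'.length_src.symm
  have h₂ := hg.length_tgt.trans hg'.length_tgt.symm
  have h₃ := hh.length_src.trans hh'.length_src.symm
  have h₄ := hh.length_tgt.trans hh'.length_tgt.symm
  obtain ⟨hbk, rfl⟩ := List.append_inj' hb h₃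
  obtain ⟨rfl, rfl⟩ := List.append_inj hbk h₁
  obtain ⟨hck, rfl⟩ := List.append_inj' hc h₄
  obtain ⟨rfl, -⟩ := List.append_inj hck h₂
  exact ⟨rfl, rfl, rfl, rfl, rfl⟩

theorem isColorInvariant_exchange (g h : Gen T) (M : List Dir) :
    IsColorInvariant A φ [⟨[], g, M ++ h.src⟩, ⟨g.tgt ++ M, h, []⟩]
      [⟨g.src ++ M, h, []⟩, ⟨[], g, M ++ h.tgt⟩] := by
  refine Or.inr ⟨_, _, rfl, fun b c _ => ?_⟩
  have h₁ : Subsingleton (TangleColoring A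
      [(⟨[], g, M ++ h.src⟩ : Slice T), ⟨g.tgt ++ M, h, []⟩] b c) := by
    refine subsingleton_pair fun m m' r₁ r₂ r₁' r₂' => ?_
    obtain ⟨b₁, k, b₂, c₁, c₂, -, hg, hh, rfl, rfl, rfl⟩ := sliceRule_exchange_left.1 ⟨r₁, r₂⟩
    obtain ⟨b₁', k', b₂', c₁', c₂', -, hg', hh', hb, rfl, hc⟩ :=
      sliceRule_exchange_left.1 ⟨r₁', r₂'⟩
    obtain ⟨rfl, rfl, rfl, rfl, rfl⟩ := hg.append_inj hg' hh hh' hb hc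
    rfl
  have h₂ : Subsingleton (TangleColoring A
      [(⟨g.src ++ M, h, []⟩ : Slice T), ⟨[], g, M ++ h.tgt⟩] b c) := by
    refine subsingleton_pair fun m m' r₁ r₂ r₁' r₂' => ?_
    obtain ⟨b₁, k, b₂, c₁, c₂, -, hg, hh, rfl, rfl, rfl⟩ := sliceRule_exchange_right.1 ⟨r₁, r₂⟩
    obtain ⟨b₁', k', b₂', c₁', c₂', -, hg', hh', hb, rfl, hc⟩ :=
      sliceRule_exchange_right.1 ⟨r₁', r₂'⟩
    obtain ⟨rfl, rfl, rfl, rfl, rfl⟩ := hg.append_inj hg' hh hh' hb hc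
    rfl
  have hw : ∀ {b₁ k b₂ c₁ c₂ : List Q}, k.length = M.length → GenRule A g b₁ c₁ →
      GenRule A h b₂ c₂ →
      sliceWeight φ (⟨[], g, M ++ h.src⟩ : Slice T) (b₁ ++ k ++ b₂) (c₁ ++ k ++ b₂) *
        sliceWeight φ ⟨g.tgt ++ M, h, []⟩ (c₁ ++ k ++ b₂) (c₁ ++ k ++ c₂) =
      sliceWeight φ (⟨g.src ++ M, h, []⟩ : Slice T) (b₁ ++ k ++ b₂) (b₁ ++ k ++ c₂) *
        sliceWeight φ ⟨[], g, M ++ h.tgt⟩ (b₁ ++ k ++ c₂) (c₁ ++ k ++ c₂) := by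
    intro b₁ k b₂ c₁ c₂ hk hg hh
    have w₁ := sliceWeight_eq (φ := φ) (s := ⟨[], g, M ++ h.src⟩) (l := []) (r := k ++ b₂) rfl hg
    have w₂ := sliceWeight_eq (φ := φ) (s := ⟨g.tgt ++ M, h, []⟩) (l := c₁ ++ k) (r := [])
      (by simp [hk, hg.length_tgt]) hh
    have w₃ := sliceWeight_eq (φ := φ) (s := ⟨g.src ++ M, h, []⟩) (l := b₁ ++ k) (r := [])
      (by simp [hk, hg.length_src]) hh
    have w₄ := sliceWeight_eq (φ := φ) (s := ⟨[], g, M ++ h.tgt⟩) (l := []) (r := k ++ c₂) rfl hg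
    simp only [List.append_nil, List.nil_append, ← List.append_assoc] at w₁ w₂ w₃ w₄
    rw [w₁, w₂, w₃, w₄, mul_comm]
  refine SameWeights.of_subsingleton fun a => ?_
  rw [exists_weights_pair, exists_weights_pair]
  constructor
  · rintro ⟨m, r₁, r₂, rfl⟩
    obtain ⟨b₁, k, b₂, c₁, c₂, hk, hg, hh, rfl, rfl, rfl⟩ := sliceRule_exchange_left.1 ⟨r₁, r₂⟩
    obtain ⟨r₃, r₄⟩ := sliceRule_exchange_right.2 ⟨b₁, k, b₂, c₁, c₂, hk, hg, hh, rfl, rfl, rfl⟩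
    exact ⟨_, r₃, r₄, (hw hk hg hh).symm⟩
  · rintro ⟨m, r₁, r₂, rfl⟩
    obtain ⟨b₁, k, b₂, c₁, c₂, hk, hg, hh, rfl, rfl, rfl⟩ := sliceRule_exchange_right.1 ⟨r₁, r₂⟩
    obtain ⟨r₃, r₄⟩ := sliceRule_exchange_left.2 ⟨b₁, k, b₂, c₁, c₂, hk, hg, hh, rfl, rfl, rfl⟩
    exact ⟨_, r₃, r₄, hw hk hg hh⟩

/-! ### Strips with at most three strands -/

section

variable {d e d₁ d₂ : Dir} {k : Kind T} {b c : List Q}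

theorem sliceRule_cup_nil_one :
    SliceRule A ⟨[], .cup d, [e]⟩ b c ↔ ∃ x z, b = [z] ∧ c = [x, x, z] := by
  simp [sliceRule_cup, List.length_eq_one_iff]
  grind

theorem sliceRule_cup_one_nil :
    SliceRule A ⟨[e], .cup d, []⟩ b c ↔ ∃ x z, b = [z] ∧ c = [z, x, x] := by
  simp [sliceRule_cup, List.length_eq_one_iff]
  grind

theorem sliceRule_cap_nil_one :
    SliceRule A ⟨[], .cap d, [e]⟩ b c ↔ ∃ x z, b = [x, x, z] ∧ c = [z] := by
  simp [sliceRule_cap, List.length_eq_one_iff]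
  grind

theorem sliceRule_cap_one_nil :
    SliceRule A ⟨[e], .cap d, []⟩ b c ↔ ∃ x z, b = [z, x, x] ∧ c = [z] := by
  simp [sliceRule_cap, List.length_eq_one_iff]
  grind

theorem sliceRule_cross_nil_one :
    SliceRule A ⟨[], .cross k d₁ d₂, [e]⟩ b c ↔ ∃ x₁ x₂ y₂ y₁ z,
      b = [x₁, x₂, z] ∧ c = [y₂, y₁, z] ∧ CrossRule A k d₁ d₂ x₁ x₂ y₂ y₁ := by
  simp [sliceRule_cross, List.length_eq_one_iff]
  grind

theorem sliceRule_cross_one_nil :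
    SliceRule A ⟨[e], .cross k d₁ d₂, []⟩ b c ↔ ∃ x₁ x₂ y₂ y₁ z,
      b = [z, x₁, x₂] ∧ c = [z, y₂, y₁] ∧ CrossRule A k d₁ d₂ x₁ x₂ y₂ y₁ := by
  simp [sliceRule_cross, List.length_eq_one_iff]
  grind

end

/-! ### Planar isotopies -/

theorem isColorInvariant_zigzagLeft (d : Dir) :
    IsColorInvariant A φ [⟨[], .cup d, [d]⟩, ⟨[d], .cap d.flip, []⟩] [] := by
  refine Or.inr ⟨_, _, rfl, fun b c hb => ?_⟩
  obtain ⟨x, rfl⟩ := List.length_eq_one_iff.1 hb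
  have : Subsingleton (TangleColoring A
      [(⟨[], .cup d, [d]⟩ : Slice T), ⟨[d], .cap d.flip, []⟩] [x] c) := by
    refine subsingleton_pair fun m m' => ?_
    simp only [sliceRule_cup_nil_one, sliceRule_cap_one_nil]
    grind
  refine SameWeights.of_subsingleton fun a => ?_
  simp only [exists_weights_pair, exists_weights_nil, sliceRule_cup_nil_one, sliceRule_cap_one_nil,
    sliceWeight_cup, sliceWeight_cap]
  grind

theorem isColorInvariant_zigzagRight (d : Dir) :
    IsColorInvariant A φ [⟨[d], .cup d.flip, []⟩, ⟨[], .cap d, [d]⟩] [] := by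
  refine Or.inr ⟨_, _, rfl, fun b c hb => ?_⟩
  obtain ⟨x, rfl⟩ := List.length_eq_one_iff.1 hb
  have : Subsingleton (TangleColoring A
      [(⟨[d], .cup d.flip, []⟩ : Slice T), ⟨[], .cap d, [d]⟩] [x] c) := by
    refine subsingleton_pair fun m m' => ?_
    simp only [sliceRule_cup_one_nil, sliceRule_cap_nil_one]
    grind
  refine SameWeights.of_subsingleton fun a => ?_
  simp only [exists_weights_pair, exists_weights_nil, sliceRule_cup_one_nil, sliceRule_cap_nil_one,
    sliceWeight_cup, sliceWeight_cap]
  grind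

/-- Turning a crossing by a right angle exchanges the two strands, reverses one of them, and changes
neither the coloring rule nor the weight. -/
theorem crossRule_flip {k : Kind T} {d e : Dir} {x₁ x₂ y₂ y₁ : Q} :
    CrossRule A k.flip e d.flip x₂ y₁ x₁ y₂ ↔ CrossRule A k d e x₁ x₂ y₂ y₁ := by
  rcases k with (_ | _) | t
  · rw [Kind.flip, Bool.not_false, crossRule_over, crossRule_under]
    constructor
    · rintro ⟨rfl, rfl⟩
      exact ⟨rfl, (under_flip_apply _ _ _).symm⟩
    · rintro ⟨rfl, rfl⟩
      exact ⟨rfl, (under_apply_flip _ _ _).symm⟩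
  · rw [Kind.flip, Bool.not_true, crossRule_over, crossRule_under, Dir.flip_flip]
    constructor
    · rintro ⟨rfl, rfl⟩
      exact ⟨rfl, rfl⟩
    · rintro ⟨rfl, rfl⟩
      exact ⟨rfl, rfl⟩
  · rw [Kind.flip, crossRule_virtual, crossRule_virtual, Dir.flip_flip, Dir.sign_flip, zpow_neg,
      Equiv.Perm.eq_inv_iff_eq, eq_comm (b := x₁), eq_comm (a := x₁), and_comm]

theorem genWeight_flip {k : Kind T} {d e : Dir} {x₁ x₂ y₂ y₁ : Q}
    (h : CrossRule A k d e x₁ x₂ y₂ y₁) :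
    genWeight φ (.cross k.flip e d.flip) [x₂, y₁] [x₁, y₂] =
      genWeight φ (.cross k d e) [x₁, x₂] [y₂, y₁] := by
  rcases k with (_ | _) | t
  · obtain ⟨rfl, rfl⟩ := crossRule_under.1 h
    have h' := genWeight_over (φ := φ) (T := T) (d₁ := e) (d₂ := d.flip) (x₁ := y₂)
      (x₂ := under e.flip y₂ x₁) (y₁ := y₂)
    rw [under_apply_flip] at h'
    have h'' := underPhi_flip (φ := φ) e.flip y₂ x₁
    rw [Dir.flip_flip] at h''
    rw [genWeight_under, Kind.flip, Bool.not_false, h', h'', Dir.sign_flip, inv_zpow, zpow_neg,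
      inv_inv]
  · obtain ⟨rfl, rfl⟩ := crossRule_over.1 h
    have h' := genWeight_under (φ := φ) (T := T) (d₁ := e) (d₂ := d.flip) (x₁ := x₂) (x₂ := y₁)
      (y₂ := y₁)
    rw [Dir.flip_flip] at h'
    rw [genWeight_over, Kind.flip, Bool.not_true, h']
  · rw [Kind.flip, genWeight_virtual, genWeight_virtual]

theorem isColorInvariant_slideCap (k : Kind T) (d e : Dir) :
    IsColorInvariant A φ [⟨[], .cross k d e, [d.flip]⟩, ⟨[e], .cap d, []⟩]
      [⟨[d], .cross k.flip e d.flip, []⟩, ⟨[], .cap d, [e]⟩] := by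
  refine Or.inr ⟨_, _, rfl, fun b c _ => ?_⟩
  have h₁ : Subsingleton (TangleColoring A
      [⟨[], .cross k d e, [d.flip]⟩, ⟨[e], .cap d, []⟩] b c) := by
    refine subsingleton_pair fun m m' => ?_
    simp only [sliceRule_cross_nil_one, sliceRule_cap_one_nil]
    grind
  have h₂ : Subsingleton (TangleColoring A
      [⟨[d], .cross k.flip e d.flip, []⟩, ⟨[], .cap d, [e]⟩] b c) := by
    refine subsingleton_pair fun m m' => ?_
    simp only [sliceRule_cross_one_nil, sliceRule_cap_nil_one]
    grind
  refine SameWeights.of_subsingleton fun a => ?_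
  simp only [exists_weights_pair, sliceRule_cross_nil_one, sliceRule_cap_one_nil,
    sliceRule_cross_one_nil, sliceRule_cap_nil_one, sliceWeight_cap, mul_one]
  constructor
  · rintro ⟨_, ⟨x₁, x₂, y₂, y₁, z, rfl, rfl, h⟩, ⟨x, z', hx, rfl⟩, rfl⟩
    obtain ⟨rfl, rfl, rfl⟩ : y₂ = z' ∧ y₁ = x ∧ z = x := by simpa using hx
    refine ⟨[x₁, x₁, y₂], ⟨x₂, z, x₁, y₂, x₁, rfl, rfl, crossRule_flip.2 h⟩,
      ⟨x₁, y₂, rfl, rfl⟩, ?_⟩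
    rw [sliceWeight_cross_nil, sliceWeight_cross_one, genWeight_flip h]
  · rintro ⟨_, ⟨x₂, z, y₂, y₁, x₁, rfl, rfl, h⟩, ⟨x, z', hx, rfl⟩, rfl⟩
    obtain ⟨rfl, rfl, rfl⟩ : x₁ = x ∧ y₂ = x ∧ y₁ = z' := by simpa using hx
    have h' := crossRule_flip.1 h
    refine ⟨[y₁, z, z], ⟨_, x₂, y₁, z, z, rfl, rfl, h'⟩, ⟨z, y₁, rfl, rfl⟩, ?_⟩
    rw [sliceWeight_cross_nil, sliceWeight_cross_one, genWeight_flip h']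

theorem isColorInvariant_slideCup (k : Kind T) (d e : Dir) :
    IsColorInvariant A φ [⟨[e], .cup d, []⟩, ⟨[], .cross k e d, [d.flip]⟩]
      [⟨[], .cup d, [e]⟩, ⟨[d], .cross k.flip d.flip e, []⟩] := by
  refine Or.inr ⟨_, _, rfl, fun b c _ => ?_⟩
  have h₁ : Subsingleton (TangleColoring A
      [⟨[e], .cup d, []⟩, ⟨[], .cross k e d, [d.flip]⟩] b c) := by
    refine subsingleton_pair fun m m' => ?_
    simp only [sliceRule_cross_nil_one, sliceRule_cup_one_nil]
    grind
  have h₂ : Subsingleton (TangleColoring A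
      [⟨[], .cup d, [e]⟩, ⟨[d], .cross k.flip d.flip e, []⟩] b c) := by
    refine subsingleton_pair fun m m' => ?_
    simp only [sliceRule_cross_one_nil, sliceRule_cup_nil_one]
    grind
  refine SameWeights.of_subsingleton fun a => ?_
  simp only [exists_weights_pair, sliceRule_cross_nil_one, sliceRule_cup_one_nil,
    sliceRule_cross_one_nil, sliceRule_cup_nil_one, sliceWeight_cup, one_mul]
  have hflip : ∀ {x₁ x₂ y₂ y₁ : Q}, CrossRule A k.flip d.flip e y₂ x₁ y₁ x₂ ↔
      CrossRule A k e d x₁ x₂ y₂ y₁ := by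
    intro x₁ x₂ y₂ y₁
    rw [← crossRule_flip (k := k.flip), Kind.flip_flip, Dir.flip_flip]
  have hweight : ∀ {x₁ x₂ y₂ y₁ : Q}, CrossRule A k e d x₁ x₂ y₂ y₁ →
      genWeight φ (.cross k.flip d.flip e) [y₂, x₁] [y₁, x₂] =
        genWeight φ (.cross k e d) [x₁, x₂] [y₂, y₁] := by
    intro x₁ x₂ y₂ y₁ h
    rw [← genWeight_flip (hflip.2 h), Kind.flip_flip, Dir.flip_flip]
  constructor
  · rintro ⟨_, ⟨x, z, rfl, rfl⟩, ⟨x₁, x₂, y₂, y₁, z', hx, rfl, h⟩, rfl⟩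
    obtain ⟨rfl, rfl, rfl⟩ : z = x₁ ∧ x = x₂ ∧ x = z' := by simpa using hx
    refine ⟨[y₂, y₂, z], ⟨y₂, z, rfl, rfl⟩, ⟨y₂, z, y₁, x, y₂, rfl, rfl, hflip.2 h⟩, ?_⟩
    rw [sliceWeight_cross_nil, sliceWeight_cross_one, hweight h]
  · rintro ⟨_, ⟨x, z, rfl, rfl⟩, ⟨x₁, x₂, y₂, y₁, z', hx, rfl, h⟩, rfl⟩
    obtain ⟨rfl, rfl, rfl⟩ : x = z' ∧ x = x₁ ∧ z = x₂ := by simpa using hx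
    have h' := hflip.1 h
    refine ⟨[z, y₁, y₁], ⟨y₁, z, rfl, rfl⟩, ⟨z, y₁, x, y₂, y₁, rfl, rfl, h'⟩, ?_⟩
    rw [sliceWeight_cross_nil, sliceWeight_cross_one, hweight h']

theorem IsotopyMove.isColorInvariant {X X' : List (Slice T)} (h : IsotopyMove X X') :
    IsColorInvariant A φ X X' := by
  cases h with
  | exchange g h M => exact isColorInvariant_exchange g h M
  | zigzagLeft d => exact isColorInvariant_zigzagLeft d
  | zigzagRight d => exact isColorInvariant_zigzagRight d
  | slideCap k d e => exact isColorInvariant_slideCap k d e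
  | slideCup k d e => exact isColorInvariant_slideCup k d e

/-! ### Kinks -/

theorem exists_crossRule_kink_right (k : Kind T) (d : Dir) (a : Q) :
    ∃ x₀, ∀ x c, CrossRule A k d d a x c x ↔ x = x₀ ∧ c = a := by
  rcases k with (_ | _) | t
  · refine ⟨a, fun x c => ?_⟩
    rw [crossRule_under]
    constructor
    · rintro ⟨rfl, h⟩
      have := (under d.flip c).injective (h.symm.trans (under_self _ _).symm)
      exact ⟨this.symm, this.symm⟩
    · rintro ⟨rfl, rfl⟩
      exact ⟨rfl, (under_self _ _).symm⟩
  · refine ⟨a, fun x c => ?_⟩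
    rw [crossRule_over]
    constructor
    · rintro ⟨rfl, rfl⟩
      exact ⟨rfl, under_self _ _⟩
    · rintro ⟨rfl, rfl⟩
      exact ⟨rfl, (under_self _ _).symm⟩
  · refine ⟨(A.op t ^ d.flip.sign) a, fun x c => ?_⟩
    rw [crossRule_virtual, Dir.sign_flip, and_comm]
    refine and_congr_right ?_
    rintro rfl
    rw [← Equiv.Perm.mul_apply, ← zpow_add, add_neg_cancel, zpow_zero, Equiv.Perm.one_apply]

theorem exists_crossRule_kink_left (k : Kind T) (d : Dir) (a : Q) :
    ∃ x₀, ∀ x c, CrossRule A k d d x a x c ↔ x = x₀ ∧ c = a := by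
  rcases k with (_ | _) | t
  · refine ⟨a, fun x c => ?_⟩
    rw [crossRule_under]
    constructor
    · rintro ⟨rfl, rfl⟩
      exact ⟨rfl, under_self _ _⟩
    · rintro ⟨rfl, rfl⟩
      exact ⟨rfl, (under_self _ _).symm⟩
  · refine ⟨a, fun x c => ?_⟩
    rw [crossRule_over]
    constructor
    · rintro ⟨rfl, h⟩
      have := (under d c).injective (h.symm.trans (under_self _ _).symm)
      exact ⟨this.symm, this.symm⟩
    · rintro ⟨rfl, rfl⟩
      exact ⟨rfl, (under_self _ _).symm⟩
  · refine ⟨(A.op t ^ d.sign) a, fun x c => ?_⟩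
    rw [crossRule_virtual, Dir.sign_flip]
    refine and_congr_right ?_
    rintro rfl
    rw [← Equiv.Perm.mul_apply, ← zpow_add, neg_add_cancel, zpow_zero, Equiv.Perm.one_apply]

theorem genWeight_kink (hφ : IsOperatorCocycle A φ) {k : Kind T} {d : Dir} {x₁ x₂ y₂ y₁ : Q}
    (h : CrossRule A k d d x₁ x₂ y₂ y₁) (hx : x₂ = y₁ ∧ y₂ = x₁ ∨ x₁ = y₂ ∧ y₁ = x₂) :
    genWeight φ (.cross k d d) [x₁, x₂] [y₂, y₁] = 1 := by
  rcases k with (_ | _) | t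
  · obtain ⟨rfl, rfl⟩ := crossRule_under.1 h
    have : y₂ = x₁ := by
      rcases hx with ⟨-, h⟩ | ⟨h, -⟩
      exacts [h, h.symm]
    rw [genWeight_under, this, underPhi_self hφ, one_zpow]
  · obtain ⟨rfl, rfl⟩ := crossRule_over.1 h
    have : x₂ = y₁ := by
      rcases hx with ⟨h, -⟩ | ⟨-, h⟩
      exacts [h, h.symm]
    rw [genWeight_over, this, underPhi_self hφ, one_zpow]
  · exact genWeight_virtual

theorem IsKink.isColorInvariant (hφ : IsOperatorCocycle A φ) {k : Kind T} {K : List (Slice T)}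
    (hK : IsKink k K) : IsColorInvariant A φ K [] := by
  cases hK with
  | right d =>
    refine Or.inr ⟨_, _, rfl, fun b c hb => ?_⟩
    obtain ⟨a, rfl⟩ := List.length_eq_one_iff.1 hb
    obtain ⟨x₀, hx₀⟩ := exists_crossRule_kink_right (A := A) k d a
    have : Subsingleton (TangleColoring A
        [⟨[d], .cup d, []⟩, ⟨[], .cross k d d, [d.flip]⟩, ⟨[d], .cap d, []⟩] [a] c) := by
      refine subsingleton_triple fun m m' n n' => ?_
      simp only [sliceRule_cup_one_nil, sliceRule_cross_nil_one, sliceRule_cap_one_nil]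
      grind
    refine SameWeights.of_subsingleton fun g => ?_
    simp only [exists_weights_triple, exists_weights_nil, sliceRule_cup_one_nil,
      sliceRule_cross_nil_one, sliceRule_cap_one_nil, sliceWeight_cup, sliceWeight_cap, one_mul,
      mul_one]
    constructor
    · rintro ⟨_, _, ⟨x, z, hz, rfl⟩, ⟨x₁, x₂, y₂, y₁, z', hx, rfl, h⟩, ⟨x', z'', hx', rfl⟩, rfl⟩
      obtain rfl : a = z := by simpa using hz
      obtain ⟨rfl, rfl, rfl⟩ : a = x₁ ∧ x = x₂ ∧ x = z' := by simpa using hx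
      obtain ⟨rfl, rfl, rfl⟩ : y₂ = z'' ∧ y₁ = x' ∧ x = x' := by simpa using hx'
      obtain ⟨-, rfl⟩ := (hx₀ _ _).1 h
      rw [sliceWeight_cross_nil, genWeight_kink hφ h (Or.inl ⟨rfl, rfl⟩)]
      exact ⟨rfl, rfl⟩
    · rintro ⟨rfl, rfl⟩
      have h := (hx₀ x₀ a).2 ⟨rfl, rfl⟩
      refine ⟨_, _, ⟨x₀, a, rfl, rfl⟩, ⟨a, x₀, a, x₀, x₀, rfl, rfl, h⟩, ⟨x₀, a, rfl, rfl⟩, ?_⟩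
      rw [sliceWeight_cross_nil, genWeight_kink hφ h (Or.inl ⟨rfl, rfl⟩)]
  | left d =>
    refine Or.inr ⟨_, _, rfl, fun b c hb => ?_⟩
    obtain ⟨a, rfl⟩ := List.length_eq_one_iff.1 hb
    obtain ⟨x₀, hx₀⟩ := exists_crossRule_kink_left (A := A) k d a
    have : Subsingleton (TangleColoring A [⟨[], .cup d.flip, [d]⟩, ⟨[d.flip], .cross k d d, []⟩,
        ⟨[], .cap d.flip, [d]⟩] [a] c) := by
      refine subsingleton_triple fun m m' n n' => ?_
      simp only [sliceRule_cup_nil_one, sliceRule_cross_one_nil, sliceRule_cap_nil_one]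
      grind
    refine SameWeights.of_subsingleton fun g => ?_
    simp only [exists_weights_triple, exists_weights_nil, sliceRule_cup_nil_one,
      sliceRule_cross_one_nil, sliceRule_cap_nil_one, sliceWeight_cup, sliceWeight_cap, one_mul,
      mul_one]
    constructor
    · rintro ⟨_, _, ⟨x, z, hz, rfl⟩, ⟨x₁, x₂, y₂, y₁, z', hx, rfl, h⟩, ⟨x', z'', hx', rfl⟩, rfl⟩
      obtain rfl : a = z := by simpa using hz
      obtain ⟨rfl, rfl, rfl⟩ : x = z' ∧ x = x₁ ∧ a = x₂ := by simpa using hx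
      obtain ⟨rfl, rfl, rfl⟩ : x = x' ∧ y₂ = x ∧ y₁ = z'' := by grind
      obtain ⟨-, rfl⟩ := (hx₀ _ _).1 h
      rw [sliceWeight_cross_one, genWeight_kink hφ h (Or.inr ⟨rfl, rfl⟩)]
      exact ⟨rfl, rfl⟩
    · rintro ⟨rfl, rfl⟩
      have h := (hx₀ x₀ a).2 ⟨rfl, rfl⟩
      refine ⟨_, _, ⟨x₀, a, rfl, rfl⟩, ⟨x₀, a, x₀, a, x₀, rfl, rfl, h⟩, ⟨x₀, a, rfl, rfl⟩, ?_⟩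
      rw [sliceWeight_cross_one, genWeight_kink hφ h (Or.inr ⟨rfl, rfl⟩)]

end LocalMoves

section UniqueColorings

variable {T : Type u} {Q : Type v} [Quandle Q] {G : Type w} [CommGroup G]
  {A : Operators T Q} {φ : Q → Q → G}

/-! ### Tangles whose colorings are determined from below -/

/-- The tangle `W` has exactly one coloring with the colours `b` on the lower boundary; it has the
colours `m` on the upper boundary and the weight `g`. -/
def HasUniqueColoring (A : Operators T Q) (φ : Q → Q → G) (W : List (Slice T)) (b m : List Q)
    (g : G) : Prop :=
  (∀ c, Subsingleton (TangleColoring A W b c)) ∧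
    ∀ c a, (∃ C, weights A φ W b c C = a) ↔ c = m ∧ a = g

theorem HasUniqueColoring.nil (b : List Q) : HasUniqueColoring A φ [] b b 1 :=
  ⟨fun _ => inferInstance, fun c a => by rw [exists_weights_nil, eq_comm]⟩

theorem HasUniqueColoring.cons {s : Slice T} {W : List (Slice T)} {b m n : List Q} {g : G}
    (hs : ∀ m', SliceRule A s b m' ↔ m' = m) (hW : HasUniqueColoring A φ W m n g) :
    HasUniqueColoring A φ (s :: W) b n (sliceWeight φ s b m * g) := by
  constructor
  · intro c
    refine ⟨?_⟩
    rintro (_ | ⟨h, C⟩) (_ | ⟨h', C'⟩)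
    obtain rfl := (hs _).1 h
    obtain rfl := (hs _).1 h'
    rw [(hW.1 c).elim C C']
  · intro c a
    rw [exists_weights_cons]
    constructor
    · rintro ⟨m', h, C, rfl⟩
      obtain rfl := (hs _).1 h
      obtain ⟨rfl, hC⟩ := (hW.2 c _).1 ⟨C, rfl⟩
      exact ⟨rfl, by rw [hC]⟩
    · rintro ⟨rfl, rfl⟩
      obtain ⟨C, hC⟩ := (hW.2 c g).2 ⟨rfl, rfl⟩
      exact ⟨m, (hs m).2 rfl, C, by rw [hC]⟩

theorem HasUniqueColoring.congr {W : List (Slice T)} {b m m' : List Q} {g g' : G}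
    (h : HasUniqueColoring A φ W b m g) (hm : m = m') (hg : g = g') :
    HasUniqueColoring A φ W b m' g' := by
  subst hm hg
  exact h

theorem HasUniqueColoring.sameWeights {W W' : List (Slice T)} {b m : List Q} {g : G}
    (h : HasUniqueColoring A φ W b m g) (h' : HasUniqueColoring A φ W' b m g) (c : List Q) :
    SameWeights (weights A φ W b c) (weights A φ W' b c) := by
  have := h.1 c
  have := h'.1 c
  exact SameWeights.of_subsingleton fun a => (h.2 c a).trans (h'.2 c a).symm

theorem HasUniqueColoring.sameWeights_pLift {W : List (Slice T)} {b m : List Q} {g : G}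
    (h : HasUniqueColoring A φ W b m g) (c : List Q) :
    SameWeights (weights A φ W b c) (fun _ : PLift (c = m) => g) := by
  have := h.1 c
  refine SameWeights.of_subsingleton fun a => (h.2 c a).trans ⟨?_, ?_⟩
  · rintro ⟨rfl, rfl⟩
    exact ⟨⟨rfl⟩, rfl⟩
  · rintro ⟨⟨rfl⟩, rfl⟩
    exact ⟨rfl, rfl⟩

theorem HasUniqueColoring.eq_of_nonempty {W : List (Slice T)} {b m c : List Q} {g : G}
    (h : HasUniqueColoring A φ W b m g) (hC : Nonempty (TangleColoring A W b c)) : c = m := by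
  obtain ⟨C⟩ := hC
  exact ((h.2 c _).1 ⟨C, rfl⟩).1

theorem HasUniqueColoring.whisker {L R : List Dir} {l r : List Q} {W : List (Slice T)}
    {b m : List Q} {g : G} (hl : l.length = L.length) (hr : r.length = R.length)
    (h : HasUniqueColoring A φ W b m g) :
    HasUniqueColoring A φ (whisker L R W) (l ++ b ++ r) (l ++ m ++ r) g := by
  have key : ∀ c', Nonempty (TangleColoring A (MultiVirtual.whisker L R W) (l ++ b ++ r) c') →
      c' = l ++ m ++ r := by
    intro c' hC
    obtain ⟨c, rfl, hC'⟩ := exists_eq_of_nonempty_whisker hl hr hC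
    rw [h.eq_of_nonempty hC']
  obtain ⟨e, he⟩ := sameWeights_whisker (A := A) (φ := φ) hl hr W b m
  constructor
  · intro c'
    refine ⟨fun C C' => ?_⟩
    obtain rfl := key c' ⟨C⟩
    have := h.1 m
    exact e.symm.injective (Subsingleton.elim _ _)
  · intro c' a
    constructor
    · rintro ⟨C, rfl⟩
      obtain rfl := key c' ⟨C⟩
      refine ⟨rfl, ((h.2 m _).1 ⟨e.symm C, ?_⟩).2⟩
      rw [← he, e.apply_symm_apply]
    · rintro ⟨rfl, rfl⟩
      obtain ⟨C, hC⟩ := (h.2 m a).2 ⟨rfl, rfl⟩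
      exact ⟨e C, (he C).trans hC⟩

/-! ### The second and third Reidemeister moves -/

theorem crossRule_classical {o : Bool} {d₁ d₂ : Dir} {x₁ x₂ y₂ y₁ : Q} :
    CrossRule A (.classical o) d₁ d₂ x₁ x₂ y₂ y₁ ↔
      y₂ = cond o (under d₁ x₁ x₂) x₂ ∧ y₁ = cond o x₁ (under d₂.flip x₂ x₁) := by
  cases o
  · exact crossRule_under
  · exact crossRule_over.trans and_comm

theorem genWeight_classical (o : Bool) (d₁ d₂ : Dir) (x₁ x₂ : Q) :
    genWeight φ (.cross (.classical o : Kind T) d₁ d₂) [x₁, x₂]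
      [cond o (under d₁ x₁ x₂) x₂, cond o x₁ (under d₂.flip x₂ x₁)] =
        cond o (underPhi φ d₁ x₁ x₂ ^ d₂.sign) (underPhi φ d₂.flip x₂ x₁ ^ d₁.sign) := by
  cases o
  · exact genWeight_under
  · exact genWeight_over

theorem HasUniqueColoring.cons_classical {L R : List Dir} {o : Bool} {d₁ d₂ : Dir}
    {W : List (Slice T)} {l r : List Q} {x₁ x₂ : Q} {n : List Q} {g : G}
    (hl : l.length = L.length) (hr : r.length = R.length)
    (hW : HasUniqueColoring A φ W
      (l ++ cond o (under d₁ x₁ x₂) x₂ :: cond o x₁ (under d₂.flip x₂ x₁) :: r) n g) :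
    HasUniqueColoring A φ (⟨L, .cross (.classical o) d₁ d₂, R⟩ :: W) (l ++ x₁ :: x₂ :: r) n
      (cond o (underPhi φ d₁ x₁ x₂ ^ d₂.sign) (underPhi φ d₂.flip x₂ x₁ ^ d₁.sign) * g) := by
  rw [← genWeight_classical (T := T), ← sliceWeight_cross (R := R) (r := r) hl]
  refine HasUniqueColoring.cons (fun m' => ?_) hW
  rw [sliceRule_cross]
  constructor
  · rintro ⟨l', r', x₁', x₂', y₂, y₁, hl', hr', h, rfl, hc⟩
    obtain ⟨rfl, h⟩ := List.append_inj h (hl.trans hl'.symm)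
    obtain ⟨rfl, rfl, rfl⟩ : x₁ = x₁' ∧ x₂ = x₂' ∧ r = r' := by simpa using h
    obtain ⟨rfl, rfl⟩ := crossRule_classical.1 hc
    rfl
  · rintro rfl
    exact ⟨l, r, x₁, x₂, _, _, hl, hr, rfl, rfl, crossRule_classical.2 ⟨rfl, rfl⟩⟩

theorem isColorInvariant_reidemeister_two (o : Bool) (d₁ d₂ : Dir) :
    IsColorInvariant A φ [⟨[], .cross (.classical o) d₁ d₂, []⟩,
      ⟨[], .cross (.classical !o) d₂ d₁, []⟩] [] := by
  refine Or.inr ⟨_, _, rfl, fun b c hb => ?_⟩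
  obtain ⟨x₁, x₂, rfl⟩ := List.length_eq_two.1 hb
  have h := HasUniqueColoring.cons_classical (A := A) (φ := φ) (L := []) (R := []) (o := o)
    (d₁ := d₁) (d₂ := d₂) (l := []) (r := []) (x₁ := x₁) (x₂ := x₂) rfl rfl
    (HasUniqueColoring.cons_classical (L := []) (R := []) (o := !o) (d₁ := d₂) (d₂ := d₁) (l := [])
      (r := []) rfl rfl (HasUniqueColoring.nil _))
  refine (h.congr ?_ ?_).sameWeights (HasUniqueColoring.nil _) c
  · cases o
    · simp only [Bool.not_false, cond_false, cond_true, List.nil_append, under_apply_flip]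
    · simp only [Bool.not_true, cond_false, cond_true, List.nil_append, under_flip_apply]
  · cases o
    · have h' := underPhi_flip (φ := φ) d₂.flip x₂ x₁
      rw [Dir.flip_flip] at h'
      simp only [Bool.not_false, cond_false, cond_true, h', inv_zpow, mul_one, mul_inv_cancel]
    · simp only [Bool.not_true, cond_false, cond_true, underPhi_flip, inv_zpow, mul_one,
        mul_inv_cancel]

theorem isColorInvariant_reidemeister_three (hφ : IsOperatorCocycle A φ) (a b c : Bool)
    (d₁ d₂ d₃ : Dir) (h : a = c → b = a) :
    IsColorInvariant A φ
      [⟨[], .cross (.classical a) d₁ d₂, [d₃]⟩, ⟨[d₂], .cross (.classical b) d₁ d₃, []⟩,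
        ⟨[], .cross (.classical c) d₂ d₃, [d₁]⟩]
      [⟨[d₁], .cross (.classical c) d₂ d₃, []⟩, ⟨[], .cross (.classical b) d₁ d₃, [d₂]⟩,
        ⟨[d₃], .cross (.classical a) d₁ d₂, []⟩] := by
  refine Or.inr ⟨_, _, rfl, fun p q hp => ?_⟩
  obtain ⟨x₁, x₂, x₃, rfl⟩ := List.length_eq_three.1 hp
  have h₁ := HasUniqueColoring.cons_classical (A := A) (φ := φ) (L := []) (R := [d₃]) (o := a)
    (d₁ := d₁) (d₂ := d₂) (l := []) (r := [x₃]) (x₁ := x₁) (x₂ := x₂) rfl rfl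
    (HasUniqueColoring.cons_classical (L := [d₂]) (R := []) (o := b) (d₁ := d₁) (d₂ := d₃)
      (l := [_]) (r := []) rfl rfl
      (HasUniqueColoring.cons_classical (L := []) (R := [d₁]) (o := c) (d₁ := d₂) (d₂ := d₃)
        (l := []) (r := [_]) rfl rfl (HasUniqueColoring.nil _)))
  have h₂ := HasUniqueColoring.cons_classical (A := A) (φ := φ) (L := [d₁]) (R := []) (o := c)
    (d₁ := d₂) (d₂ := d₃) (l := [x₁]) (r := []) (x₁ := x₂) (x₂ := x₃) rfl rfl
    (HasUniqueColoring.cons_classical (L := []) (R := [d₂]) (o := b) (d₁ := d₁) (d₂ := d₃)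
      (l := []) (r := [_]) rfl rfl
      (HasUniqueColoring.cons_classical (L := [d₃]) (R := []) (o := a) (d₁ := d₁) (d₂ := d₂)
        (l := [_]) (r := []) rfl rfl (HasUniqueColoring.nil _)))
  have hphi : ∀ (dm dt : Dir) (m t x : Q) (n : ℤ),
      underPhi φ dm m x ^ n * underPhi φ dt t (under dm m x) ^ n =
        underPhi φ dt t x ^ n * underPhi φ dm (under dt t m) (under dt t x) ^ n :=
    fun dm dt m t x n => by rw [← mul_zpow, ← mul_zpow, underPhi_cocycle hφ]
  -- In each of the six cases, `H` and `K` are `under_under` and the cocycle condition, applied to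
  -- the arc of the middle strand that the lowest strand, followed upwards, meets before the top
  -- strand. The weight of the crossing of the top and the middle strand is the same on both sides.
  suffices H : _ ∧ _ from (h₁.congr H.1 H.2).sameWeights h₂ q
  clear h₁ h₂
  cases a <;> cases b <;> cases c <;>
    first
    | exact absurd (h rfl) (by decide)
    | skip
  all_goals
    clear h
    simp only [cond_false, cond_true, mul_one, List.nil_append, List.cons_append, List.cons.injEq,
      and_true, true_and]
  · have H := under_under d₂.flip d₃.flip x₂ x₃ x₁
    have K := hphi d₂.flip d₃.flip x₂ x₃ x₁ d₁.sign
    grind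
  · have H := under_under d₃.flip d₂.flip (under d₂ x₂ x₃) x₂ x₁
    have K := hphi d₃.flip d₂.flip (under d₂ x₂ x₃) x₂ x₁ d₁.sign
    rw [under_flip_apply] at H K
    grind
  · have H := under_under d₁ d₂ (under d₂.flip x₂ x₁) x₂ x₃
    have K := hphi d₁ d₂ (under d₂.flip x₂ x₁) x₂ x₃ d₃.sign
    rw [under_apply_flip] at H K
    grind
  · have H := under_under d₁ d₃.flip x₁ x₃ x₂
    have K := hphi d₁ d₃.flip x₁ x₃ x₂ d₂.sign
    grind
  · have H := under_under d₃.flip d₁ x₃ x₁ x₂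
    have K := hphi d₃.flip d₁ x₃ x₁ x₂ d₂.sign
    grind
  · have H := under_under d₂ d₁ x₂ x₁ x₃
    have K := hphi d₂ d₁ x₂ x₁ x₃ d₃.sign
    grind

theorem ReidemeisterMove.isColorInvariant (hφ : IsOperatorCocycle A φ) {X X' : List (Slice T)}
    (h : ReidemeisterMove X X') : IsColorInvariant A φ X X' := by
  cases h with
  | r1 o hK => exact hK.isColorInvariant hφ
  | r2 o d₁ d₂ => exact isColorInvariant_reidemeister_two o d₁ d₂
  | r3 a b c d₁ d₂ d₃ h => exact isColorInvariant_reidemeister_three hφ a b c d₁ d₂ d₃ h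

end UniqueColorings

/-! ### Symmetries of colorings -/

theorem map_map_inv {Q : Type v} (β : Equiv.Perm Q) (b : List Q) : (b.map ⇑β⁻¹).map β = b := by
  rw [List.map_map, show ⇑β ∘ ⇑β⁻¹ = id from funext β.apply_symm_apply, List.map_id]

theorem map_inv_map {Q : Type v} (β : Equiv.Perm Q) (b : List Q) : (b.map β).map ⇑β⁻¹ = b := by
  rw [List.map_map, show ⇑β⁻¹ ∘ ⇑β = id from funext β.symm_apply_apply, List.map_id]

section Symmetries

variable {T : Type u} {Q : Type v} [Quandle Q] {G : Type w} {A : Operators T Q} {φ : Q → Q → G}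

/-- A permutation of the colours that preserves the coloring rules and the weights of all
crossings. -/
structure IsSymmetry {G : Type w} (A : Operators T Q) (φ : Q → Q → G) (β : Equiv.Perm Q) :
    Prop where
  map_act : ∀ x y : Q, β (x ◃ y) = β x ◃ β y
  comm : ∀ t : T, Commute (A.op t) β
  invariant : ∀ x y : Q, φ (β x) (β y) = φ x y

theorem IsSymmetry.inv {β : Equiv.Perm Q} (h : IsSymmetry A φ β) : IsSymmetry A φ β⁻¹ where
  map_act x y := by
    obtain ⟨x, rfl⟩ := β.surjective x
    obtain ⟨y, rfl⟩ := β.surjective y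
    rw [← h.map_act]
    simp
  comm t := (h.comm t).inv_right
  invariant x y := by
    rw [← h.invariant]
    simp

theorem IsSymmetry.map_under {β : Equiv.Perm Q} (h : IsSymmetry A φ β) (d : Dir) (z x : Q) :
    β (under d z x) = under d (β z) (β x) := by
  cases d
  · exact h.map_act z x
  · rw [under_down, under_down, ← Rack.left_cancel (β z), ← h.map_act, Rack.right_inv,
      Rack.right_inv]

theorem IsSymmetry.crossRule {β : Equiv.Perm Q} (h : IsSymmetry A φ β) {k : Kind T} {d₁ d₂ : Dir}
    {x₁ x₂ y₂ y₁ : Q} (hc : CrossRule A k d₁ d₂ x₁ x₂ y₂ y₁) :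
    CrossRule A k d₁ d₂ (β x₁) (β x₂) (β y₂) (β y₁) := by
  rcases k with (_ | _) | t
  · obtain ⟨rfl, rfl⟩ := crossRule_under.1 hc
    exact crossRule_under.2 ⟨rfl, h.map_under _ _ _⟩
  · obtain ⟨rfl, rfl⟩ := crossRule_over.1 hc
    exact crossRule_over.2 ⟨rfl, h.map_under _ _ _⟩
  · obtain ⟨rfl, rfl⟩ := crossRule_virtual.1 hc
    have hcomm : ∀ (n : ℤ) (x : Q), β ((A.op t ^ n) x) = (A.op t ^ n) (β x) := fun n x =>
      (Equiv.Perm.ext_iff.1 ((h.comm t).zpow_left n).eq x).symm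
    exact crossRule_virtual.2 ⟨hcomm _ _, hcomm _ _⟩

theorem IsSymmetry.genRule {β : Equiv.Perm Q} (h : IsSymmetry A φ β) {g : Gen T} {b c : List Q}
    (hg : GenRule A g b c) : GenRule A g (b.map β) (c.map β) := by
  cases g with
  | cup d =>
    obtain ⟨x, rfl, rfl⟩ := genRule_cup.1 hg
    exact genRule_cup.2 ⟨β x, rfl, rfl⟩
  | cap d =>
    obtain ⟨x, rfl, rfl⟩ := genRule_cap.1 hg
    exact genRule_cap.2 ⟨β x, rfl, rfl⟩
  | cross k d₁ d₂ =>
    obtain ⟨x₁, x₂, y₂, y₁, rfl, rfl, hc⟩ := genRule_cross.1 hg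
    exact genRule_cross.2 ⟨_, _, _, _, rfl, rfl, h.crossRule hc⟩

theorem IsSymmetry.sliceRule {β : Equiv.Perm Q} (h : IsSymmetry A φ β) {s : Slice T} {b c : List Q}
    (hs : SliceRule A s b c) : SliceRule A s (b.map β) (c.map β) := by
  obtain ⟨l, r, b', c', hl, hr, rfl, rfl, hg⟩ := hs
  exact ⟨l.map β, r.map β, b'.map β, c'.map β, by simpa using hl, by simpa using hr, by simp,
    by simp, h.genRule hg⟩

end Symmetries

section Detour

variable {T : Type u} {Q : Type v} [Quandle Q] {G : Type w} [CommGroup G]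
  {A : Operators T Q} {φ : Q → Q → G}

theorem IsOperatorCocycle.isSymmetry (hφ : IsOperatorCocycle A φ) (t : T) (d : Dir) :
    IsSymmetry A φ (A.op t ^ d.sign) := by
  have h : IsSymmetry A φ (A.op t) :=
    ⟨A.map_act t, fun s => A.comm s t, hφ.invariant t⟩
  cases d
  · rw [Dir.sign, zpow_one]
    exact h
  · rw [Dir.sign, zpow_neg_one]
    exact h.inv

theorem IsSymmetry.underPhi {β : Equiv.Perm Q} (h : IsSymmetry A φ β) (d : Dir) (z x : Q) :
    underPhi φ d (β z) (β x) = underPhi φ d z x := by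
  cases d
  · exact h.invariant x z
  · have h' : β z ◃⁻¹ β x = β (z ◃⁻¹ x) := (h.map_under .down z x).symm
    rw [MultiVirtual.underPhi, MultiVirtual.underPhi, h', h.invariant]

theorem IsSymmetry.genWeight {β : Equiv.Perm Q} (h : IsSymmetry A φ β) {g : Gen T} {b c : List Q}
    (hg : GenRule A g b c) : genWeight φ g (b.map β) (c.map β) = genWeight φ g b c := by
  cases g with
  | cup d => rw [genWeight_cup, genWeight_cup]
  | cap d => rw [genWeight_cap, genWeight_cap]
  | cross k d₁ d₂ =>
    obtain ⟨x₁, x₂, y₂, y₁, rfl, rfl, hc⟩ := genRule_cross.1 hg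
    simp only [List.map_cons, List.map_nil]
    rcases k with (_ | _) | t
    · obtain ⟨rfl, rfl⟩ := crossRule_under.1 hc
      rw [h.map_under, genWeight_under, genWeight_under, h.underPhi]
    · obtain ⟨rfl, rfl⟩ := crossRule_over.1 hc
      rw [h.map_under, genWeight_over, genWeight_over, h.underPhi]
    · rw [genWeight_virtual, genWeight_virtual]

theorem IsSymmetry.sliceWeight {β : Equiv.Perm Q} (h : IsSymmetry A φ β) (s : Slice T)
    (b c : List Q) (hs : SliceRule A s b c) :
    sliceWeight φ s (b.map β) (c.map β) = sliceWeight φ s b c := by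
  obtain ⟨l, r, b', c', hl, hr, rfl, rfl, hg⟩ := hs
  rw [sliceWeight_eq hl hg, ← h.genWeight hg]
  simp only [List.map_append]
  exact sliceWeight_eq (by simpa using hl) (h.genRule hg)

/-- A symmetry, applied to all colours, acts on the colorings of a tangle. -/
theorem IsSymmetry.sameWeights {β : Equiv.Perm Q} (h : IsSymmetry A φ β) (W : List (Slice T))
    (b c : List Q) :
    SameWeights (weights A φ W b c) (weights A φ W (b.map β) (c.map β)) := by
  have := sameWeights_map (A := A) (φ := φ) (F := List.map β) (σ := id) β.injective.list_map ?_
    h.sliceWeight W b c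
  · rwa [List.map_id] at this
  · intro s b c'
    constructor
    · intro hs
      refine ⟨c'.map ⇑β⁻¹, map_map_inv β c', ?_⟩
      have := h.inv.sliceRule hs
      rwa [map_inv_map] at this
    · rintro ⟨c, rfl, hs⟩
      exact h.sliceRule hs

/-! ### Detour moves -/

/-- The number of upward strands minus the number of downward strands. -/
def winding (m : List Dir) : ℤ := (m.map Dir.sign).sum

theorem winding_src_eq_tgt (s : Slice T) : winding s.src = winding s.tgt := by
  rcases s with ⟨L, g, R⟩
  cases g <;> simp [Slice.src, Slice.tgt, Gen.src, Gen.tgt, winding, Dir.sign_flip, add_left_comm]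

/-- Every strand of a tangle contributes equally to both boundaries. -/
theorem IsTangle.winding_eq {m n : List Dir} {W : List (Slice T)} (h : IsTangle m W n) :
    winding m = winding n := by
  induction W generalizing m with
  | nil => rw [show m = n from h]
  | cons s W ih => rw [h.1, winding_src_eq_tgt, ih h.2]

/-- A strand sweeping over the strands `m` from left to right applies the same automorphism to the
colours of all of them, whatever their directions. Its own colour is changed by a power of the
operator that depends only on the winding of `m`. -/
theorem hasUniqueColoring_sweep (t : T) (d : Dir) (m : List Dir) (x : Q) (b : List Q)
    (hb : b.length = m.length) :
    HasUniqueColoring A φ (sweep t d m) (x :: b)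
      (b.map ⇑(A.op t ^ d.sign) ++ [(A.op t ^ (-winding m)) x]) 1 := by
  induction m generalizing x b with
  | nil =>
    obtain rfl := List.length_eq_zero_iff.1 hb
    exact HasUniqueColoring.nil _
  | cons e m ih =>
    rcases b with _ | ⟨y, b⟩
    · simp at hb
    have hb' : b.length = m.length := by simpa using hb
    have h := (ih ((A.op t ^ e.flip.sign) x) b hb').whisker (L := [e]) (R := [])
      (l := [(A.op t ^ d.sign) y]) (r := []) rfl rfl
    have hs : ∀ m', SliceRule A ⟨[], .cross (.virtual t) d e, m⟩ (x :: y :: b) m' ↔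
        m' = (A.op t ^ d.sign) y :: (A.op t ^ e.flip.sign) x :: b := by
      intro m'
      rw [sliceRule_cross]
      constructor
      · rintro ⟨l, r, x₁, x₂, y₂, y₁, hl, -, h, rfl, hc⟩
        obtain rfl := List.length_eq_zero_iff.1 hl
        obtain ⟨rfl, rfl, rfl⟩ : x = x₁ ∧ y = x₂ ∧ b = r := by simpa using h
        obtain ⟨rfl, rfl⟩ := crossRule_virtual.1 hc
        rfl
      · rintro rfl
        exact ⟨[], b, x, y, _, _, rfl, hb', rfl, rfl, crossRule_virtual.2 ⟨rfl, rfl⟩⟩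
    refine (HasUniqueColoring.cons hs ((List.append_nil _).symm ▸ h)).congr ?_ ?_
    · have hw : winding (e :: m) = e.sign + winding m := by simp [winding]
      rw [← Equiv.Perm.mul_apply, ← zpow_add, Dir.sign_flip, hw, neg_add_rev]
      simp
    · rw [sliceWeight_virtual, one_mul]

theorem isColorInvariant_across (hφ : IsOperatorCocycle A φ) (t : T) (d : Dir) {m n : List Dir}
    {W : List (Slice T)} (hW : IsTangle m W n) :
    IsColorInvariant A φ (sweep t d m ++ whisker [] [d] W) (whisker [d] [] W ++ sweep t d n) := by
  have key : ∀ b c : List Q, b.length = m.length + 1 →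
      SameWeights (weights A φ (sweep t d m ++ whisker [] [d] W) b c)
        (weights A φ (whisker [d] [] W ++ sweep t d n) b c) := by
    intro b c hb
    rcases b with _ | ⟨x, b⟩
    · simp at hb
    have hb' : b.length = m.length := by simpa using hb
    set β := A.op t ^ d.sign with hβ
    set x' := (A.op t ^ (-winding m)) x with hx'
    have hleft := hasUniqueColoring_sweep (A := A) (φ := φ) t d m x b hb'
    rw [← hβ, ← hx'] at hleft
    have hright : ∀ c₁, Nonempty (TangleColoring A W b c₁) →
        HasUniqueColoring A φ (sweep t d n) (x :: c₁) (c₁.map β ++ [x']) 1 := by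
      rintro c₁ ⟨C⟩
      rw [hx', hW.winding_eq]
      exact hasUniqueColoring_sweep t d n x c₁ (C.length_eq hW hb')
    refine (sameWeights_append_of_unique_left hleft.sameWeights_pLift).trans ?_
    by_cases hc : ∃ c₁ : List Q, c = c₁.map β ++ [x']
    · obtain ⟨c, rfl⟩ := hc
      have h₁ := sameWeights_whisker (A := A) (φ := φ) (L := []) (R := [d]) (l := []) (r := [x'])
        rfl rfl W (b.map β) (c.map β)
      have h₂ := (hφ.isSymmetry t d).sameWeights W b c
      have h₃ := sameWeights_whisker (A := A) (φ := φ) (L := [d]) (R := []) (l := [x]) (r := [])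
        rfl rfl W b c
      rw [List.append_nil, List.append_nil] at h₃
      refine h₁.symm.trans (h₂.symm.trans (h₃.trans (SameWeights.symm ?_)))
      refine sameWeights_append_of_unique_right fun c' hC => ?_
      rw [← List.append_nil (x :: b)] at hC
      obtain ⟨c₁, rfl, hC'⟩ := exists_eq_of_nonempty_whisker (l := [x]) rfl rfl hC
      rw [List.append_nil]
      refine ((hright c₁ hC').sameWeights_pLift _).trans ?_
      have hiff : c.map β ++ [x'] = c₁.map β ++ [x'] ↔ [x] ++ c₁ = [x] ++ c := by
        rw [List.append_left_inj, List.append_right_inj, β.injective.list_map.eq_iff, eq_comm]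
      refine SameWeights.of_subsingleton fun a => ?_
      exact ⟨fun ⟨p, hp⟩ => ⟨⟨hiff.1 p.down⟩, hp⟩, fun ⟨p, hp⟩ => ⟨⟨hiff.2 p.down⟩, hp⟩⟩
    · have h₁ : IsEmpty (TangleColoring A (whisker [] [d] W) (b.map β ++ [x']) c) := by
        refine not_nonempty_iff.1 fun hC => hc ?_
        obtain ⟨c₁, rfl, -⟩ := exists_eq_of_nonempty_whisker (l := []) (r := [x']) rfl rfl hC
        exact ⟨c₁.map ⇑β⁻¹, by rw [map_map_inv, List.nil_append]⟩
      have h₂ : IsEmpty (TangleColoring A (whisker [d] [] W ++ sweep t d n) (x :: b) c) := by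
        refine not_nonempty_iff.1 fun hC => hc ?_
        obtain ⟨c', hC₁, hC₂⟩ := nonempty_append_iff.1 hC
        rw [← List.append_nil (x :: b)] at hC₁
        obtain ⟨c₁, rfl, hC'⟩ := exists_eq_of_nonempty_whisker (l := [x]) rfl rfl hC₁
        rw [List.append_nil] at hC₂
        exact ⟨c₁, (hright c₁ hC').eq_of_nonempty hC₂⟩
      exact SameWeights.of_isEmpty _ _
  rcases m with _ | ⟨e, m⟩
  · rcases W with _ | ⟨s, W⟩
    · obtain rfl : [] = n := hW
      exact Or.inl rfl
    · refine Or.inr ⟨_, _, rfl, fun b c hb => key b c ?_⟩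
      have := congrArg List.length hW.1
      simp [Slice.src] at this hb ⊢
      omega
  · refine Or.inr ⟨_, _, rfl, fun b c hb => key b c ?_⟩
    rw [hb]
    simp [Slice.src, Gen.src]

theorem DetourMove.isColorInvariant (hφ : IsOperatorCocycle A φ) {X X' : List (Slice T)}
    (h : DetourMove X X') : IsColorInvariant A φ X X' := by
  cases h with
  | across t d hW => exact isColorInvariant_across hφ t d hW
  | loop t hK => exact hK.isColorInvariant hφ

/-! ### Moves in link diagrams -/

theorem IsTangle.of_append {m n : List Dir} {W W' : List (Slice T)} (h : IsTangle m (W ++ W') n) :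
    ∃ p, IsTangle m W p ∧ IsTangle p W' n := by
  induction W generalizing m with
  | nil => exact ⟨m, rfl, h⟩
  | cons s W ih =>
    obtain ⟨p, hp, hp'⟩ := ih h.2
    exact ⟨p, ⟨h.1, hp⟩, hp'⟩

theorem IsColorInvariant.whisker {X X' : List (Slice T)} (h : IsColorInvariant A φ X X')
    (L R : List Dir) :
    IsColorInvariant A φ (whisker L R X) (whisker L R X') := by
  rcases h with rfl | ⟨s, W, rfl, h⟩
  · exact Or.inl rfl
  refine Or.inr ⟨_, _, rfl, fun b c hb => ?_⟩
  have hlen : b.length = L.length + s.src.length + R.length := by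
    simp only [hb, Slice.src, List.length_append]
    omega
  obtain ⟨l, b, r, rfl, hl, hr⟩ : ∃ l b' r, b = l ++ b' ++ r ∧ l.length = L.length ∧
      r.length = R.length := by
    refine ⟨b.take L.length, (b.drop L.length).take s.src.length,
      (b.drop L.length).drop s.src.length, ?_, ?_, ?_⟩
    · rw [List.append_assoc, List.take_append_drop, List.take_append_drop]
    · rw [List.length_take]
      omega
    · rw [List.length_drop, List.length_drop]
      omega
  have hb' : b.length = s.src.length := by
    simp only [List.length_append] at hlen
    omega
  by_cases hc : ∃ c', l ++ c' ++ r = c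
  · obtain ⟨c, rfl⟩ := hc
    exact (sameWeights_whisker hl hr _ b c).symm.trans
      ((h b c hb').trans (sameWeights_whisker hl hr _ b c))
  · have hE : ∀ W : List (Slice T),
        IsEmpty (TangleColoring A (MultiVirtual.whisker L R W) (l ++ b ++ r) c) := fun W =>
      not_nonempty_iff.1 fun hC => hc <| by
        obtain ⟨c', hc', -⟩ := exists_eq_of_nonempty_whisker hl hr hC
        exact ⟨c', hc'⟩
    have := hE (s :: W)
    have := hE X'
    exact SameWeights.of_isEmpty _ _

theorem Diagram.Step.sameWeights (hφ : IsOperatorCocycle A φ) {D D' : Diagram T}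
    (h : D.Step D') :
    SameWeights (weights A φ D.strips [] []) (weights A φ D'.strips [] []) := by
  obtain ⟨X, X', L, R, below, above, hX, hD, hD'⟩ := h
  have hinv : IsColorInvariant A φ X X' := by
    rcases hX with h | h | h
    · exact h.isColorInvariant
    · exact h.isColorInvariant hφ
    · exact h.isColorInvariant hφ
  rw [hD', hD]
  rcases hinv.whisker L R with h | ⟨s, W, hs, h⟩
  · rw [h]
    exact SameWeights.refl _
  · have hclosed := D.closed
    rw [hD, hs, List.append_assoc] at hclosed
    obtain ⟨p, hp, hp'⟩ := hclosed.of_append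
    rw [List.append_assoc, List.append_assoc]
    refine SameWeights.append (fun m => SameWeights.refl _) ?_
    rintro b ⟨C⟩
    have hb : b.length = s.src.length := by rw [← hp'.1, C.length_eq hp rfl]
    exact SameWeights.append (fun m => h b m hb) fun _ _ => SameWeights.refl _

theorem Diagram.Equivalent.sameWeights (hφ : IsOperatorCocycle A φ) {D D' : Diagram T}
    (h : D.Equivalent D') :
    SameWeights (weights A φ D.strips [] []) (weights A φ D'.strips [] []) := by
  induction h with
  | rel _ _ h => exact Diagram.Step.sameWeights hφ h
  | refl _ => exact SameWeights.refl _
  | symm _ _ _ ih => exact ih.symm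
  | trans _ _ _ _ _ ih ih' => exact ih.trans ih'

end Detour

end MultiVirtual

theorem theorem4p2 {T : Type*} {Q : Type*} [Quandle Q] {G : Type*} [CommGroup G]
    (A : MultiVirtual.Operators T Q) (φ : Q → Q → G) (hφ : MultiVirtual.IsOperatorCocycle A φ)
    (D₁ D₂ : MultiVirtual.Diagram T) (h : D₁.Equivalent D₂) :
    (Finite (MultiVirtual.Coloring A D₁) ↔ Finite (MultiVirtual.Coloring A D₂)) ∧
      MultiVirtual.Coc D₁ A φ = MultiVirtual.Coc D₂ A φ := by
  obtain ⟨e, he⟩ := h.sameWeights hφ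
  refine ⟨e.finite_iff, ?_⟩
  unfold MultiVirtual.Coc
  rw [← finsum_comp_equiv e]
  exact finsum_congr fun C => congrArg _ (he C).symm
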